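/- **Setting.** Let $(\Gamma,d)$ be a countable metric space that is $\nu$-regular: there are $\kappa,\nu>0$ such that every closed ball of radius $n+1$ in $\Gamma$ has at most $\kappa(n+1)^\nu$ points, for all integers $n\ge 0$. To each $x\in\Gamma$ associate a nonzero finite-dimensional complex Hilbert space $\mathcal H_x$. For finite $\Lambda\subset\Gamma$ let $\mathcal H_\Lambda=\bigotimes_{x\in\Lambda}\mathcal H_x$ and $\mathcal A_\Lambda=\mathcal B(\mathcal H_\Lambda)$ with the operator norm; for $Z\subset\Lambda$ regard $\mathcal A_Z\cong\mathcal A_Z\otimes 1$ as a subalgebra of $\mathcal A_\Lambda$, and let a linear map $\Phi$ on $\mathcal A_Z$ act on $\mathcal A_\Lambda$ as $\Phi\otimes\mathrm{id}_{\Lambda\setminus Z}$. For a linear map $\Phi$ on $\mathcal A_Z$ put $\|\Phi\|_{cb}=\sup_{n}\|\Phi\otimes \mathrm{id}_{\mathbb M_n}\|$. A dissipative interaction is a family $\mathscr L=\{L_Z\}$, indexed by the finite sets $Z\subset\Gamma$, of linear maps $L_Z:\mathcal A_Z\to\mathcal A_Z$ of Lindblad form $$L_Z(A)=i[H_Z,A]+\sum_{j=1}^{\ell_Z}\Big(K_j^*AK_j-\tfrac12\{K_j^*K_j,A\}\Big),\qquad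 H_Z=H_Z^*\in\mathcal A_Z,\ K_j\in\mathcal A_Z .$$ For finite $\Lambda$ let $\mathscr L^\Lambda=\sum_{Z\subset\Lambda}L_Z$ and $T^\Lambda_t=e^{t\mathscr L^\Lambda}$, $t\ge 0$. For $F:[0,\infty)\to(0,\infty)$ let $\|\mathscr L\|_F$ be the infimum of all $M$ with $\sum_{Z\ni x,y}\|L_Z\|_{cb}\le M\,F(d(x,y))$ for all $x,y\in\Gamma$ (sum over finite $Z$), and let $C_F$ be the infimum of all $C$ with $\sum_{z\in\Gamma}F(d(x,z))F(d(z,y))\le C\,F(d(x,y))$ for all $x,y\in\Gamma$. **Theorem.** Let $F(r)=(1+r)^{-\alpha}$ with $\alpha>2\nu+1$, and let $\mathscr L$ be a dissipative interaction with $\|\mathscr L\|_F<\infty$. Put $v=\|\mathscr L\|_F\,C_F$. Fix $\epsilon\in(0,\alpha-2\nu-1)$, set $\alpha_\epsilon=\alpha-\nu-1-\epsilon$ and $C_\epsilon=\sum_{n\ge0}(1+n)^{-(1+\epsilon)}$, and let $0<\delta<1$ satisfy $(1-\delta)\alpha_\epsilon>\nu$. Let $X,Y\subset\Gamma$ be nonempty,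 finite and disjoint, with distance $d(X,Y)=\min_{x\in X,\,y\in Y}d(x,y)$, let $\Lambda\subset\Gamma$ be finite with $X\cup Y\subset\Lambda$, let $A\in\mathcal A_X$, and let $K$ be a completely bounded linear map on $\mathcal A_Y$ with $K(1)=0$. Then there is $C>0$ for which $$\|K(T^\Lambda_t(A))\|\le C\,\|K\|_{cb}\,\|A\|\,|X|\cdot\frac{t}{(1+d(X,Y))^{(1-\delta)\alpha_\epsilon-\nu}}$$ whenever $d(X,Y)\ge1$, $t\ge 0$ and $e\,v\,t\le d(X,Y)^\delta$. Moreover, the inequality holds under the same conditions with $$C=\kappa\,C_\epsilon\,\|\mathscr L\|_F\left(e+\kappa\,2^{2\alpha_\epsilon}\,2^{1-\delta}\,\frac{C_\epsilon+C_F}{C_F}\right).$$ -/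

import Mathlib

open scoped ENNReal NNReal Matrix Matrix.Norms.L2Operator

noncomputable section

namespace LRB

/-! ### Metric notions -/

/-- `(Γ, d)` is `ν`-regular with constant `κ`: every closed ball of radius `n + 1`
has at most `κ (n + 1) ^ ν` points, for all natural numbers `n`. -/
def IsRegular (Γ : Type*) [MetricSpace Γ] (κ ν : ℝ) : Prop :=
  ∀ (x : Γ) (n : ℕ), (Metric.closedBall x ((n : ℝ) + 1)).Finite ∧
    ((Metric.closedBall x ((n : ℝ) + 1)).ncard : ℝ) ≤ κ * ((n : ℝ) + 1) ^ ν

/-- The distance `d(X, Y)` between two nonempty finite sets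
(the value is `0` when one of the sets is empty). -/
def setDist {Γ : Type*} [MetricSpace Γ] (X Y : Finset Γ) : ℝ :=
  sInf {r : ℝ | ∃ x ∈ X, ∃ y ∈ Y, r = dist x y}

/-- The power law `F(r) = 1 / (1 + r) ^ α`. -/
def powerLaw (α : ℝ) (r : ℝ) : ℝ := 1 / (1 + r) ^ α

/-- The convolution constant `C_F`: the infimum of all `C` such that
`∑ z, F(d(x,z)) F(d(z,y)) ≤ C F(d(x,y))` for all `x, y`
(it is `∞` if and only if there is no finite such `C`). -/
def convConst (Γ : Type*) [MetricSpace Γ] (F : ℝ → ℝ) : ℝ≥0∞ :=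
  sInf {C : ℝ≥0∞ | ∀ x y : Γ,
    ∑' z : Γ, ENNReal.ofReal (F (dist x z)) * ENNReal.ofReal (F (dist z y))
      ≤ C * ENNReal.ofReal (F (dist x y))}

/-! ### Linear maps on finite-dimensional normed spaces -/

/-- The operator norm of a linear map on a finite-dimensional normed space. -/
def opNorm {E : Type*} [NormedAddCommGroup E] [NormedSpace ℂ E] [FiniteDimensional ℂ E]
    (Φ : E →ₗ[ℂ] E) : ℝ≥0∞ :=
  ‖LinearMap.toContinuousLinearMap Φ‖ₑ

/-- The semigroup `exp (t Φ)` generated by a linear map `Φ` on a finite-dimensional normed space,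
the exponential being that of the Banach algebra of continuous linear maps. -/
def expFlow {E : Type*} [NormedAddCommGroup E] [NormedSpace ℂ E] [FiniteDimensional ℂ E]
    (Φ : E →ₗ[ℂ] E) (t : ℝ) : E →ₗ[ℂ] E :=
  (NormedSpace.exp ((t : ℂ) • LinearMap.toContinuousLinearMap Φ) : E →L[ℂ] E).toLinearMap

/-! ### Matrix algebras, Lindblad generators, completely bounded norm

Matrix algebras carry the operator norm of `ℂ^m` with its Hilbert space norm. -/

/-- `Φ ⊗ id` on `n × n` block matrices with entries in a matrix algebra: `Φ` acts on each block. -/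
def ampliation {m : Type*} (n : ℕ)
    (Φ : Matrix m m ℂ →ₗ[ℂ] Matrix m m ℂ) :
    Matrix (m × Fin n) (m × Fin n) ℂ →ₗ[ℂ] Matrix (m × Fin n) (m × Fin n) ℂ where
  toFun M := Matrix.of fun p q =>
    Φ (Matrix.of fun a b => M (a, p.2) (b, q.2)) p.1 q.1
  map_add' M N := by
    ext p q
    exact congrFun (congrFun (Φ.map_add (Matrix.of fun a b => M (a, p.2) (b, q.2))
      (Matrix.of fun a b => N (a, p.2) (b, q.2))) p.1) q.1
  map_smul' c M := by
    ext p q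
    exact congrFun (congrFun (Φ.map_smul c (Matrix.of fun a b => M (a, p.2) (b, q.2))) p.1) q.1

/-- The completely bounded norm `‖Φ‖_cb = sup_n ‖Φ ⊗ id_n‖`. -/
def cbNorm {m : Type*} [Fintype m] [DecidableEq m]
    (Φ : Matrix m m ℂ →ₗ[ℂ] Matrix m m ℂ) : ℝ≥0∞ :=
  ⨆ n : ℕ, opNorm (ampliation n Φ)

/-- `Φ` is of Lindblad form:
`Φ(A) = i[H, A] + ∑ j, (K_j* A K_j - ½ (K_j* K_j A + A K_j* K_j))` with `H` self-adjoint. -/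
def IsLindblad {m : Type*} [Fintype m]
    (Φ : Matrix m m ℂ →ₗ[ℂ] Matrix m m ℂ) : Prop :=
  ∃ (H : Matrix m m ℂ) (l : ℕ) (K : Fin l → Matrix m m ℂ), H.IsHermitian ∧
    ∀ A : Matrix m m ℂ, Φ A = Complex.I • (H * A - A * H) +
      ∑ j, ((K j)ᴴ * A * K j - (1 / 2 : ℂ) • ((K j)ᴴ * K j * A + A * ((K j)ᴴ * K j)))

/-- The class of completely bounded maps that annihilate the identity. -/
def IsCB0 {m : Type*} [Fintype m] [DecidableEq m]
    (Φ : Matrix m m ℂ →ₗ[ℂ] Matrix m m ℂ) : Prop :=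
  cbNorm Φ < ∞ ∧ Φ 1 = 0

/-! ### The quantum spin system

The single-site Hilbert space at `x` is `ℂ^(ι x)`, where `ι x` labels an orthonormal basis. Then
`⨂ x ∈ Λ, ℂ^(ι x)` has the orthonormal basis labelled by the configurations `Π x ∈ Λ, ι x`. -/

/-- The configurations on `Λ`, i.e. the labels of the product basis of the Hilbert space of `Λ`. -/
abbrev Config {Γ : Type*} (ι : Γ → Type*) (Λ : Finset Γ) : Type _ := ∀ x : Λ, ι x

/-- The algebra of observables on the finite volume `Λ`. -/
abbrev LocalAlg {Γ : Type*} (ι : Γ → Type*) (Λ : Finset Γ) : Type _ :=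
  Matrix (Config ι Λ) (Config ι Λ) ℂ

section Spin

variable {Γ : Type*} [DecidableEq Γ] {ι : Γ → Type*}

/-- Restriction of a configuration on `Λ` to a subset `Z`. -/
def Config.restrict {Z Λ : Finset Γ} (h : Z ⊆ Λ) (σ : Config ι Λ) : Config ι Z :=
  fun x => σ ⟨x.1, h x.2⟩

/-- The configuration on `Λ` equal to `a` on `Z` and to `σ` on `Λ \ Z`. -/
def Config.glue {Z Λ : Finset Γ} (a : Config ι Z) (σ : Config ι Λ) : Config ι Λ :=
  fun x => if hx : x.1 ∈ Z then a ⟨x.1, hx⟩ else σ x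

/-- The embedding of observables on `X` into those on `Λ`, given by `A ↦ A ⊗ 1_{Λ \ X}`. -/
def embed [∀ x, DecidableEq (ι x)] {X Λ : Finset Γ} (h : X ⊆ Λ) (A : LocalAlg ι X) :
    LocalAlg ι Λ :=
  Matrix.of fun σ τ =>
    if ∀ x : Λ, x.1 ∉ X → σ x = τ x then A (σ.restrict h) (τ.restrict h) else 0

/-- The map `Φ ⊗ id_{Λ \ Z}` on the observables on `Λ`, for a linear map `Φ` on the observables
on `Z`: `Φ` acts on each of the blocks labelled by the configurations on `Λ \ Z`. -/
def extend {Z Λ : Finset Γ} (h : Z ⊆ Λ) (Φ : LocalAlg ι Z →ₗ[ℂ] LocalAlg ι Z) :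
    LocalAlg ι Λ →ₗ[ℂ] LocalAlg ι Λ where
  toFun M := Matrix.of fun σ τ =>
    Φ (Matrix.of fun a b => M (a.glue σ) (b.glue τ)) (σ.restrict h) (τ.restrict h)
  map_add' M N := by
    ext σ τ
    exact congrFun (congrFun (Φ.map_add (Matrix.of fun a b => M (a.glue σ) (b.glue τ))
      (Matrix.of fun a b => N (a.glue σ) (b.glue τ))) (σ.restrict h)) (τ.restrict h)
  map_smul' c M := by
    ext σ τ
    exact congrFun (congrFun (Φ.map_smul c (Matrix.of fun a b => M (a.glue σ) (b.glue τ)))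
      (σ.restrict h)) (τ.restrict h)

/-- A dissipative interaction: for each finite `Z` a linear map of Lindblad form on the
observables on `Z`. -/
structure Interaction (ι : Γ → Type*) [∀ x, Fintype (ι x)] where
  /-- the local term on `Z` -/
  term : (Z : Finset Γ) → (LocalAlg ι Z →ₗ[ℂ] LocalAlg ι Z)
  lindblad : ∀ Z, IsLindblad (term Z)

variable [∀ x, Fintype (ι x)] [∀ x, DecidableEq (ι x)]

/-- The `F`-norm of an interaction: the infimum of all `M` such that
`∑_{Z ∋ x, y} ‖L_Z‖_cb ≤ M F(d(x,y))` for all `x, y` (`∞` if there is no finite such `M`). -/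
def Interaction.fNorm [MetricSpace Γ] (L : Interaction ι) (F : ℝ → ℝ) : ℝ≥0∞ :=
  sInf {M : ℝ≥0∞ | ∀ x y : Γ,
    ∑' Z : {Z : Finset Γ // x ∈ Z ∧ y ∈ Z}, cbNorm (L.term Z.1)
      ≤ M * ENNReal.ofReal (F (dist x y))}

/-- The finite-volume generator `∑_{Z ⊆ Λ} L_Z`, each `L_Z` acting as `L_Z ⊗ id`. -/
def Interaction.generator (L : Interaction ι) (Λ : Finset Γ) :
    LocalAlg ι Λ →ₗ[ℂ] LocalAlg ι Λ :=
  ∑ Z ∈ Λ.powerset.attach, extend (Finset.mem_powerset.1 Z.2) (L.term Z.1)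

/-- The finite-volume dynamics `T_t = exp (t 𝓛)`, with `𝓛` the generator of the volume `Λ`. -/
def Interaction.dynamics (L : Interaction ι) (Λ : Finset Γ) (t : ℝ) :
    LocalAlg ι Λ →ₗ[ℂ] LocalAlg ι Λ :=
  expFlow (L.generator Λ) t

end Spin

end LRB

end

/-!
A Lindblad generator `Φ` is such that `1 + h Φ` is completely positive and unital up to `O(h²)`,
hence a contraction up to `O(h²)`. This property passes to sums of generators, so all the dynamics
are contraction semigroups.

For an observable `A` on `X` and a map `K` on `Y` vanishing on constants, Duhamel's formula bounds
the growth of `K (T_t A)` by the terms of the generator touching `Y`, each of which is again a map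
vanishing on constants. Iterating, contractivity yields a Lieb–Robinson bound with the decay of `F`
and the growth `e ^ (v t)`.

To replace the exponential growth in `t` by a linear one, the interaction is cut at the scale
`R = d(X, Y) ^ (1 - δ)`. The terms of diameter at most `R` obey a Lieb–Robinson bound with an
additional factor `e ^ (-r / R)`, which absorbs `e ^ (v t)` as long as `e v t ≤ d(X, Y) / R`. The
longer terms enter only to first order, through Duhamel's formula, and are summed with the tails
of `F`.
-/

noncomputable section

namespace LRB

open Filter Topology
open scoped Kronecker

/-! ### Contraction semigroups -/

section Semigroup

variable {E : Type*} [NormedAddCommGroup E] [NormedSpace ℂ E]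

/-- The semigroup `exp (t P)` generated by a bounded operator `P`. -/
def flow (P : E →L[ℂ] E) (t : ℝ) : E →L[ℂ] E :=
  NormedSpace.exp ((t : ℂ) • P)

/-- A quantitative form of dissipativity: `1 + h P` is a contraction up to an error of order `h²`.
For bounded `P` this is what makes `exp (t P)` a contraction, and it is stable under sums. -/
def IsDissipative (P : E →L[ℂ] E) : Prop :=
  ∃ C : ℝ, ∀ h : ℝ, 0 ≤ h → ‖1 + (h : ℂ) • P‖ ≤ 1 + C * h ^ 2

theorem IsDissipative.zero : IsDissipative (0 : E →L[ℂ] E) :=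
  ⟨0, fun h _ => by simpa [ContinuousLinearMap.one_def] using ContinuousLinearMap.norm_id_le⟩

theorem IsDissipative.add {P Q : E →L[ℂ] E} (hP : IsDissipative P) (hQ : IsDissipative Q) :
    IsDissipative (P + Q) := by
  obtain ⟨C, hC⟩ := hP
  obtain ⟨D, hD⟩ := hQ
  refine ⟨2 * (C + D), fun h hh => ?_⟩
  -- `1 + h (P + Q)` is the midpoint of `1 + 2h P` and `1 + 2h Q`.
  have hmid : 1 + (h : ℂ) • (P + Q) = (1 / 2 : ℂ) • (1 + ((2 * h : ℝ) : ℂ) • P) +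
      (1 / 2 : ℂ) • (1 + ((2 * h : ℝ) : ℂ) • Q) := by
    push_cast
    module
  have hhalf : ‖(1 / 2 : ℂ)‖ = 1 / 2 := by norm_num
  calc ‖1 + (h : ℂ) • (P + Q)‖
      ≤ 1 / 2 * ‖1 + ((2 * h : ℝ) : ℂ) • P‖ + 1 / 2 * ‖1 + ((2 * h : ℝ) : ℂ) • Q‖ := by
        rw [hmid]
        simpa only [norm_smul, hhalf] using norm_add_le ((1 / 2 : ℂ) • (1 + ((2 * h : ℝ) : ℂ) • P))
          ((1 / 2 : ℂ) • (1 + ((2 * h : ℝ) : ℂ) • Q))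
    _ ≤ 1 / 2 * (1 + C * (2 * h) ^ 2) + 1 / 2 * (1 + D * (2 * h) ^ 2) := by
        gcongr
        exacts [hC _ (by positivity), hD _ (by positivity)]
    _ = 1 + 2 * (C + D) * h ^ 2 := by ring

theorem IsDissipative.sum {ι : Type*} {s : Finset ι} {P : ι → E →L[ℂ] E}
    (h : ∀ i ∈ s, IsDissipative (P i)) : IsDissipative (∑ i ∈ s, P i) :=
  Finset.sum_induction P IsDissipative (fun _ _ => IsDissipative.add) .zero h

theorem flow_zero (P : E →L[ℂ] E) : flow P 0 = 1 := by
  simp [flow]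

theorem hasDerivAt_clm_apply {f : ℝ → E →L[ℂ] E} {f' : E →L[ℂ] E} {s : ℝ}
    (h : HasDerivAt f f' s) (A : E) : HasDerivAt (fun s => f s A) (f' A) s :=
  ((ContinuousLinearMap.apply ℂ E A).restrictScalars ℝ).hasFDerivAt.comp_hasDerivAt s h

theorem IsDissipative.eventually_slope_norm_lt {P : E →L[ℂ] E} (hP : IsDissipative P)
    {g : ℝ → E} {x : ℝ} (hg : HasDerivAt g (P (g x)) x) {r : ℝ} (hr : 0 < r) :
    ∀ᶠ z in 𝓝[>] x, slope (fun s => ‖g s‖) x z < r := by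
  obtain ⟨C, hC⟩ := hP
  have hlim : Tendsto (fun z => C * (z - x) * ‖g x‖ + ‖slope g x z - P (g x)‖) (𝓝[>] x) (𝓝 0) := by
    have hsub : Tendsto (fun z => C * (z - x) * ‖g x‖) (𝓝[>] x) (𝓝 0) :=
      ((by fun_prop : Continuous fun z => C * (z - x) * ‖g x‖).tendsto' x 0 (by simp)).mono_left
        nhdsWithin_le_nhds
    have hslope : Tendsto (slope g x) (𝓝[>] x) (𝓝 (P (g x))) :=
      hg.tendsto_slope.mono_left (nhdsWithin_mono x fun z (hz : x < z) => hz.ne')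
    simpa using hsub.add (tendsto_iff_norm_sub_tendsto_zero.1 hslope)
  filter_upwards [hlim.eventually (gt_mem_nhds hr), self_mem_nhdsWithin] with z hz (hxz : x < z)
  refine lt_of_le_of_lt ?_ hz
  have hh : 0 < z - x := sub_pos.2 hxz
  have hsplit : g z = (1 + ((z - x : ℝ) : ℂ) • P) (g x) + (z - x) • (slope g x z - P (g x)) := by
    rw [smul_sub, sub_smul_slope, vsub_eq_sub, Complex.coe_smul]
    simp
  have hnorm : ‖g z‖ ≤ (1 + C * (z - x) ^ 2) * ‖g x‖ + (z - x) * ‖slope g x z - P (g x)‖ := by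
    calc ‖g z‖ ≤ ‖(1 + ((z - x : ℝ) : ℂ) • P) (g x)‖ + ‖(z - x) • (slope g x z - P (g x))‖ := by
          rw [hsplit]
          exact norm_add_le _ _
      _ ≤ _ := by
          rw [norm_smul, Real.norm_of_nonneg hh.le]
          gcongr
          exact ContinuousLinearMap.le_of_opNorm_le _ (hC _ hh.le) _
  rw [slope_def_field, div_le_iff₀ hh]
  linear_combination hnorm

variable [CompleteSpace E]

theorem hasDerivAt_flow (P : E →L[ℂ] E) (s : ℝ) : HasDerivAt (flow P) (P * flow P s) s :=
  ((hasDerivAt_exp_smul_const' P (s : ℂ)).scomp s Complex.ofRealCLM.hasDerivAt).congr_deriv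
    (by simp [flow])

theorem hasDerivAt_flow_const_sub (P : E →L[ℂ] E) (t s : ℝ) :
    HasDerivAt (fun s => flow P (t - s)) (-(flow P (t - s) * P)) s := by
  have h : HasDerivAt (flow P) (flow P (t - s) * P) (t - s) :=
    ((hasDerivAt_exp_smul_const P ((t - s : ℝ) : ℂ)).scomp (t - s)
      Complex.ofRealCLM.hasDerivAt).congr_deriv (by simp [flow])
  exact (h.scomp s ((hasDerivAt_id s).const_sub t)).congr_deriv (by simp)

theorem hasDerivAt_flow_sub_apply_flow_add {P Q k : E →L[ℂ] E} (hk : Commute P k) (A : E)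
    (t s : ℝ) :
    HasDerivAt (fun s => flow P (t - s) (k (flow (P + Q) s A)))
      (flow P (t - s) (k (Q (flow (P + Q) s A)))) s := by
  have h := hasDerivAt_clm_apply ((hasDerivAt_flow_const_sub P t s).mul
    ((hasDerivAt_flow (P + Q) s).const_mul k)) A
  refine h.congr_deriv ?_
  have hcancel : -(flow P (t - s) * P) * (k * flow (P + Q) s) +
      flow P (t - s) * (k * ((P + Q) * flow (P + Q) s))
        = flow P (t - s) * (k * (Q * flow (P + Q) s)) := by
    calc _ = flow P (t - s) * ((k * P - P * k) * flow (P + Q) s) +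
          flow P (t - s) * (k * (Q * flow (P + Q) s)) := by noncomm_ring
      _ = _ := by rw [hk.eq, sub_self, zero_mul, mul_zero, zero_add]
  rw [hcancel]
  rfl

theorem IsDissipative.norm_flow_le_one {P : E →L[ℂ] E} (hP : IsDissipative P) {t : ℝ}
    (ht : 0 ≤ t) : ‖flow P t‖ ≤ 1 := by
  refine ContinuousLinearMap.opNorm_le_bound _ zero_le_one fun A => ?_
  have hd (s : ℝ) : HasDerivAt (fun s => flow P s A) (P (flow P s A)) s :=
    hasDerivAt_clm_apply (hasDerivAt_flow P s) A
  refine image_le_of_liminf_slope_right_le_deriv_boundary (f := fun s => ‖flow P s A‖)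
    (B := fun _ => 1 * ‖A‖) (B' := 0) (a := 0) (b := t)
    (fun s _ => (hd s).continuousAt.norm.continuousWithinAt) (by simp [flow_zero])
    continuousOn_const (fun s _ => hasDerivWithinAt_const _ _ _)
    (fun s _ r hr => (hP.eventually_slope_norm_lt (hd s) hr).frequently) ⟨ht, le_rfl⟩

theorem norm_flow_add_sub_flow_le {P Q : E →L[ℂ] E}
    (hPQ : ∀ s : ℝ, 0 ≤ s → ‖flow (P + Q) s‖ ≤ 1) (A : E) {t B : ℝ} (ht : 0 ≤ t)
    (hB : ∀ s : ℝ, 0 ≤ s → s ≤ t → ‖Q (flow P s A)‖ ≤ B) :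
    ‖flow (P + Q) t A - flow P t A‖ ≤ B * t := by
  -- Duhamel's interpolation between the two semigroups
  have hd (s : ℝ) : HasDerivAt (fun s => (flow (P + Q) (t - s) * flow P s) A)
      (-(flow (P + Q) (t - s) (Q (flow P s A)))) s :=
    (hasDerivAt_clm_apply ((hasDerivAt_flow_const_sub (P + Q) t s).mul (hasDerivAt_flow P s))
      A).congr_deriv (by simp)
  have hderiv (s : ℝ) (hs : s ∈ Set.Ico 0 t) : ‖-(flow (P + Q) (t - s) (Q (flow P s A)))‖ ≤ B := by
    rw [norm_neg]
    calc ‖flow (P + Q) (t - s) (Q (flow P s A))‖ ≤ 1 * ‖Q (flow P s A)‖ :=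
          ContinuousLinearMap.le_of_opNorm_le _ (hPQ _ (sub_nonneg.2 hs.2.le)) _
      _ ≤ B := by simpa using hB s hs.1 hs.2.le
  simpa [flow_zero, norm_sub_rev] using norm_image_sub_le_of_norm_deriv_right_le_segment
    (fun s _ => (hd s).continuousAt.continuousWithinAt) (fun s _ => (hd s).hasDerivWithinAt)
    hderiv t ⟨ht, le_rfl⟩

end Semigroup

/-! ### Norms in matrix algebras and Lindblad generators -/

section MatrixNorm

variable {m n : Type*} [Fintype m] [DecidableEq m] [Fintype n] [DecidableEq n]

theorem norm_matrix_one_le : ‖(1 : Matrix m m ℂ)‖ ≤ 1 := by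
  rw [← Matrix.diagonal_one, Matrix.l2_opNorm_diagonal]
  exact (pi_norm_le_iff_of_nonneg zero_le_one).2 fun _ => by simp

theorem norm_reindex_le (e : m ≃ n) (M : Matrix m m ℂ) : ‖M.reindex e e‖ ≤ ‖M‖ := by
  let φ : Matrix m m ℂ →⋆ₐ[ℂ] Matrix n n ℂ :=
    { (Matrix.reindexAlgEquiv ℂ ℂ e : Matrix m m ℂ →ₐ[ℂ] Matrix n n ℂ) with
      map_star' := fun M => (Matrix.conjTranspose_reindex e e M).symm }
  exact NonUnitalStarAlgHom.norm_apply_le φ M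

theorem norm_reindex (e : m ≃ n) (M : Matrix m m ℂ) : ‖M.reindex e e‖ = ‖M‖ :=
  (norm_reindex_le e M).antisymm <| by simpa using norm_reindex_le e.symm (M.reindex e e)

theorem norm_kronecker_one_le (A : Matrix m m ℂ) : ‖A ⊗ₖ (1 : Matrix n n ℂ)‖ ≤ ‖A‖ := by
  let φ : Matrix m m ℂ →⋆ₙₐ[ℂ] Matrix (m × n) (m × n) ℂ :=
    { toFun := fun A => A ⊗ₖ 1
      map_mul' := fun A B => by rw [← Matrix.mul_kronecker_mul, one_mul]
      map_zero' := Matrix.zero_kronecker _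
      map_add' := fun A B => Matrix.add_kronecker A B _
      map_smul' := fun c A => Matrix.smul_kronecker c A _
      map_star' := fun A => by
        rw [Matrix.star_eq_conjTranspose, Matrix.star_eq_conjTranspose,
          Matrix.conjTranspose_kronecker, Matrix.conjTranspose_one] }
  exact NonUnitalStarAlgHom.norm_apply_le φ A

theorem norm_conjTranspose_mul_kronecker_one_mul_le (V : Matrix (m × n) m ℂ) (A : Matrix m m ℂ) :
    ‖Vᴴ * (A ⊗ₖ (1 : Matrix n n ℂ)) * V‖ ≤ ‖A‖ * ‖Vᴴ * V‖ :=
  calc ‖Vᴴ * (A ⊗ₖ (1 : Matrix n n ℂ)) * V‖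
      ≤ ‖Vᴴ‖ * ‖A ⊗ₖ (1 : Matrix n n ℂ)‖ * ‖V‖ :=
        (Matrix.l2_opNorm_mul _ _).trans <|
          mul_le_mul_of_nonneg_right (Matrix.l2_opNorm_mul _ _) (norm_nonneg _)
    _ ≤ ‖V‖ * ‖A‖ * ‖V‖ := by
        rw [Matrix.l2_opNorm_conjTranspose]
        gcongr
        exact norm_kronecker_one_le A
    _ = ‖A‖ * ‖Vᴴ * V‖ := by rw [Matrix.l2_opNorm_conjTranspose_mul_self]; ring

omit [DecidableEq n] in
theorem norm_sum_conjTranspose_mul_mul_le (W : n → Matrix m m ℂ) (A : Matrix m m ℂ) :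
    ‖∑ j, (W j)ᴴ * A * W j‖ ≤ ‖A‖ * ‖∑ j, (W j)ᴴ * W j‖ := by
  classical
  -- the Stinespring dilation of `A ↦ ∑ j, (W j)ᴴ * A * W j`
  let V : Matrix (m × n) m ℂ := Matrix.of fun p b => W p.2 p.1 b
  have hV (B : Matrix m m ℂ) : Vᴴ * (B ⊗ₖ (1 : Matrix n n ℂ)) * V = ∑ j, (W j)ᴴ * B * W j := by
    ext a b
    simp only [Matrix.mul_apply, Matrix.sum_apply, Fintype.sum_prod_type,
      Matrix.kroneckerMap_apply, Matrix.one_apply, Matrix.conjTranspose_apply, Matrix.of_apply, V,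
      mul_ite, mul_one, mul_zero, Finset.sum_ite_eq', Finset.mem_univ, if_true]
    rw [Finset.sum_comm]
  have hV1 : Vᴴ * V = ∑ j, (W j)ᴴ * W j := by
    simpa only [Matrix.one_kronecker_one, Matrix.mul_one] using hV 1
  rw [← hV A, ← hV1]
  exact norm_conjTranspose_mul_kronecker_one_mul_le V A

namespace IsLindblad

variable {Φ : Matrix m m ℂ →ₗ[ℂ] Matrix m m ℂ}

theorem map_one (h : IsLindblad Φ) : Φ 1 = 0 := by
  obtain ⟨H, l, K, -, hΦ⟩ := h
  rw [hΦ]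
  simp only [mul_one, one_mul, sub_self, smul_zero, zero_add]
  exact Finset.sum_eq_zero fun j _ => by module

omit [DecidableEq m] in
theorem exists_eq_add_sum (h : IsLindblad Φ) :
    ∃ (G : Matrix m m ℂ) (l : ℕ) (K : Fin l → Matrix m m ℂ),
      ∀ A, Φ A = Gᴴ * A + A * G + ∑ j, (K j)ᴴ * A * K j := by
  obtain ⟨H, l, K, hH, hΦ⟩ := h
  refine ⟨-(Complex.I • H) - (1 / 2 : ℂ) • ∑ j, (K j)ᴴ * K j, l, K, fun A => ?_⟩
  have hG : (-(Complex.I • H) - (1 / 2 : ℂ) • ∑ j, (K j)ᴴ * K j)ᴴ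
      = Complex.I • H - (1 / 2 : ℂ) • ∑ j, (K j)ᴴ * K j := by
    simp [Matrix.conjTranspose_sub, Matrix.conjTranspose_smul, Matrix.conjTranspose_sum,
      Matrix.conjTranspose_mul, hH.eq]
  rw [hΦ, hG]
  simp only [Finset.sum_sub_distrib, ← Finset.smul_sum, Finset.sum_add_distrib,
    ← Finset.sum_mul, ← Finset.mul_sum, sub_mul, mul_sub, smul_mul_assoc, mul_smul_comm,
    smul_add, smul_sub, mul_neg]
  abel

omit [DecidableEq m] in
theorem exists_kraus (h : IsLindblad Φ) :
    ∃ (G : Matrix m m ℂ) (l : ℕ), ∀ s : ℝ, 0 ≤ s → ∃ W : Option (Fin l) → Matrix m m ℂ,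
      ∀ A, ∑ o, (W o)ᴴ * A * W o = A + (s : ℂ) • Φ A + (s : ℂ) ^ 2 • (Gᴴ * A * G) := by
  classical
  obtain ⟨G, l, K, hΦ⟩ := h.exists_eq_add_sum
  refine ⟨G, l, fun s hs => ⟨fun o => o.elim (1 + (s : ℂ) • G) fun j => ((√s : ℝ) : ℂ) • K j,
    fun A => ?_⟩⟩
  have hsq : ((√s : ℝ) : ℂ) * ((√s : ℝ) : ℂ) = (s : ℂ) := by
    rw [← Complex.ofReal_mul, Real.mul_self_sqrt hs]
  rw [Fintype.sum_option, hΦ]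
  simp only [Option.elim, Matrix.conjTranspose_add, Matrix.conjTranspose_smul,
    Matrix.conjTranspose_one, Complex.star_def, Complex.conj_ofReal, smul_mul_assoc,
    mul_smul_comm, smul_smul, hsq, add_mul, mul_add, one_mul, mul_one, smul_add,
    ← Finset.smul_sum, pow_two]
  abel

theorem isDissipative (h : IsLindblad Φ) : IsDissipative (LinearMap.toContinuousLinearMap Φ) := by
  obtain ⟨G, l, hG⟩ := h.exists_kraus
  refine ⟨2 * ‖G‖ ^ 2, fun s hs =>
    ContinuousLinearMap.opNorm_le_bound _ (by positivity) fun A => ?_⟩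
  obtain ⟨W, hW⟩ := hG s hs
  have hrest (B : Matrix m m ℂ) : ‖(s : ℂ) ^ 2 • (Gᴴ * B * G)‖ ≤ s ^ 2 * ‖G‖ ^ 2 * ‖B‖ := by
    calc ‖(s : ℂ) ^ 2 • (Gᴴ * B * G)‖ ≤ s ^ 2 * (‖Gᴴ‖ * ‖B‖ * ‖G‖) := by
          rw [norm_smul, norm_pow, Complex.norm_real, Real.norm_eq_abs, sq_abs]
          gcongr
          exact (norm_mul_le _ _).trans (by gcongr; exact norm_mul_le _ _)
      _ = s ^ 2 * ‖G‖ ^ 2 * ‖B‖ := by rw [Matrix.l2_opNorm_conjTranspose]; ring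
  have hone : ‖∑ o, (W o)ᴴ * W o‖ ≤ 1 + s ^ 2 * ‖G‖ ^ 2 := by
    have hW1 : ∑ o, (W o)ᴴ * W o = 1 + (s : ℂ) ^ 2 • (Gᴴ * 1 * G) := by
      simpa only [mul_one, h.map_one, smul_zero, add_zero] using hW 1
    rw [hW1]
    exact (norm_add_le _ _).trans <| add_le_add norm_matrix_one_le <|
      (hrest 1).trans <| mul_le_of_le_one_right (by positivity) norm_matrix_one_le
  calc ‖(1 + (s : ℂ) • LinearMap.toContinuousLinearMap Φ) A‖
      = ‖∑ o, (W o)ᴴ * A * W o - (s : ℂ) ^ 2 • (Gᴴ * A * G)‖ := by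
        rw [hW A, add_sub_cancel_right]
        rfl
    _ ≤ ‖A‖ * (1 + s ^ 2 * ‖G‖ ^ 2) + s ^ 2 * ‖G‖ ^ 2 * ‖A‖ := by
        refine (norm_sub_le _ _).trans (add_le_add ?_ (hrest A))
        exact (norm_sum_conjTranspose_mul_mul_le W A).trans (by gcongr)
    _ = (1 + 2 * ‖G‖ ^ 2 * s ^ 2) * ‖A‖ := by ring

end IsLindblad

theorem norm_ampliation_le {Φ : Matrix m m ℂ →ₗ[ℂ] Matrix m m ℂ} (hΦ : cbNorm Φ < ∞) (k : ℕ)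
    (M : Matrix (m × Fin k) (m × Fin k) ℂ) :
    ‖ampliation k Φ M‖ ≤ (cbNorm Φ).toReal * ‖M‖ := by
  have hk : opNorm (ampliation k Φ) ≤ cbNorm Φ := le_iSup (fun k => opNorm (ampliation k Φ)) k
  exact ContinuousLinearMap.le_of_opNorm_le _
    (by simpa [opNorm] using ENNReal.toReal_mono hΦ.ne hk) M

end MatrixNorm

/-! ### Local observables and local maps -/

section Local

variable {Γ : Type*} [DecidableEq Γ] {ι : Γ → Type*} {X Y Z Λ : Finset Γ}

namespace Config

theorem restrict_glue (h : Z ⊆ Λ) (a : Config ι Z) (σ : Config ι Λ) :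
    (a.glue σ).restrict h = a := by
  ext x
  simp [glue, restrict]

theorem glue_restrict (h : Z ⊆ Λ) (σ : Config ι Λ) : (σ.restrict h).glue σ = σ := by
  ext x
  by_cases hx : x.1 ∈ Z <;> simp [glue, restrict, hx]

theorem glue_glue (a b : Config ι Z) (σ : Config ι Λ) : a.glue (b.glue σ) = a.glue σ := by
  ext x
  by_cases hx : x.1 ∈ Z <;> simp [glue, hx]

theorem restrict_glue_of_disjoint (hd : Disjoint Z X) (h : X ⊆ Λ) (a : Config ι Z)
    (σ : Config ι Λ) : (a.glue σ).restrict h = σ.restrict h := by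
  ext x
  simp [glue, restrict, Finset.disjoint_right.1 hd x.2]

theorem glue_eq_glue_off_iff (hd : Disjoint X Y) (hY : Y ⊆ Λ) (a b : Config ι Y)
    (σ τ : Config ι Λ) :
    (∀ x : Λ, x.1 ∉ X → a.glue σ x = b.glue τ x) ↔
      a = b ∧ ∀ x : Λ, x.1 ∉ X → x.1 ∉ Y → σ x = τ x := by
  constructor
  · refine fun h => ⟨funext fun y => ?_, fun x hX hx => ?_⟩
    · simpa [glue] using h ⟨y.1, hY y.2⟩ (Finset.disjoint_right.1 hd y.2)
    · simpa [glue, hx] using h x hX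
  · rintro ⟨rfl, h⟩ x hX
    by_cases hx : x.1 ∈ Y
    · simp [glue, hx]
    · simpa [glue, hx] using h x hX hx

/-- The splitting of the configurations on `Λ` into those on `Z` and those on `Λ \ Z`. -/
def split (h : Z ⊆ Λ) : Config ι Λ ≃ Config ι Z × Config ι (Λ \ Z) where
  toFun σ := (σ.restrict h, σ.restrict Finset.sdiff_subset)
  invFun p x := if hx : x.1 ∈ Z then p.1 ⟨x.1, hx⟩
    else p.2 ⟨x.1, Finset.mem_sdiff.2 ⟨x.2, hx⟩⟩
  left_inv σ := by
    ext x
    by_cases hx : x.1 ∈ Z <;> simp [restrict, hx]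
  right_inv p := by
    refine Prod.ext (funext fun x => by simp [restrict]) (funext fun x => ?_)
    simp [restrict, (Finset.mem_sdiff.1 x.2).2]

theorem glue_eq_split_symm (h : Z ⊆ Λ) (a : Config ι Z) (σ : Config ι Λ) :
    a.glue σ = (split h).symm (a, σ.restrict Finset.sdiff_subset) := rfl

theorem glue_split_symm (h : Z ⊆ Λ) (a : Config ι Z) (p : Config ι Z × Config ι (Λ \ Z)) :
    a.glue ((split h).symm p) = (split h).symm (a, p.2) := by
  ext x
  by_cases hx : x.1 ∈ Z <;> simp [glue, split, hx]

end Config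

section Block

/-- The block of an observable on `Λ`, seen as a matrix over the observables on `Z`, whose row and
column are the values of the configurations `σ` and `τ` outside `Z`. -/
def block (Z : Finset Γ) (σ τ : Config ι Λ) : LocalAlg ι Λ →ₗ[ℂ] LocalAlg ι Z where
  toFun M := Matrix.of fun a b => M (a.glue σ) (b.glue τ)
  map_add' _ _ := rfl
  map_smul' _ _ := rfl

theorem block_apply (σ τ : Config ι Λ) (M : LocalAlg ι Λ) (a b : Config ι Z) :
    block Z σ τ M a b = M (a.glue σ) (b.glue τ) := rfl

theorem block_conjTranspose (σ τ : Config ι Λ) (M : LocalAlg ι Λ) :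
    block Z σ τ Mᴴ = (block Z τ σ M)ᴴ := rfl

theorem ext_block (h : Z ⊆ Λ) {M N : LocalAlg ι Λ}
    (hMN : ∀ σ τ, block Z σ τ M = block Z σ τ N) : M = N := by
  ext σ τ
  simpa only [block_apply, Config.glue_restrict] using
    congrFun₂ (hMN σ τ) (σ.restrict h) (τ.restrict h)

theorem block_extend (h : Z ⊆ Λ) (Φ : LocalAlg ι Z →ₗ[ℂ] LocalAlg ι Z) (σ τ : Config ι Λ)
    (M : LocalAlg ι Λ) : block Z σ τ (extend h Φ M) = Φ (block Z σ τ M) := by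
  ext a b
  change Φ (block Z (a.glue σ) (b.glue τ) M) ((a.glue σ).restrict h) ((b.glue τ).restrict h) = _
  have hglue : block Z (a.glue σ) (b.glue τ) M = block Z σ τ M := by
    ext c d
    simp only [block_apply, Config.glue_glue]
  rw [hglue, Config.restrict_glue, Config.restrict_glue]

end Block

section Embed

variable [∀ x, DecidableEq (ι x)]

theorem embed_eq_submatrix (h : X ⊆ Λ) (A : LocalAlg ι X) :
    embed h A = (A ⊗ₖ (1 : LocalAlg ι (Λ \ X))).submatrix (Config.split h) (Config.split h) := by
  ext σ τ
  have hiff : (∀ x : Λ, x.1 ∉ X → σ x = τ x) ↔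
      σ.restrict (Finset.sdiff_subset : Λ \ X ⊆ Λ) = τ.restrict Finset.sdiff_subset := by
    simp [funext_iff, Config.restrict]
  simp only [embed, Matrix.of_apply, hiff, Matrix.submatrix_apply, Matrix.kroneckerMap_apply,
    Matrix.one_apply, mul_ite, mul_one, mul_zero]
  rfl

theorem embed_conjTranspose (h : X ⊆ Λ) (A : LocalAlg ι X) : (embed h A)ᴴ = embed h Aᴴ := by
  rw [embed_eq_submatrix, embed_eq_submatrix, Matrix.conjTranspose_submatrix,
    Matrix.conjTranspose_kronecker, Matrix.conjTranspose_one]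

theorem block_embed_of_disjoint (hX : X ⊆ Λ) (hY : Y ⊆ Λ) (hd : Disjoint X Y) (A : LocalAlg ι X)
    (σ τ : Config ι Λ) : ∃ c : ℂ, block Y σ τ (embed hX A) = c • 1 := by
  refine ⟨if ∀ x : Λ, x.1 ∉ X → x.1 ∉ Y → σ x = τ x then
    A (σ.restrict hX) (τ.restrict hX) else 0, ?_⟩
  ext a b
  simp only [block_apply, embed, Matrix.of_apply, Config.glue_eq_glue_off_iff hd hY,
    Config.restrict_glue_of_disjoint hd.symm, Matrix.smul_apply, Matrix.one_apply, smul_eq_mul,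
    mul_ite, mul_one, mul_zero, ite_and]

theorem extend_embed_eq_zero (hX : X ⊆ Λ) (hY : Y ⊆ Λ) (hd : Disjoint X Y)
    {Φ : LocalAlg ι Y →ₗ[ℂ] LocalAlg ι Y} (hΦ : Φ 1 = 0) (A : LocalAlg ι X) :
    extend hY Φ (embed hX A) = 0 := by
  refine ext_block hY fun σ τ => ?_
  obtain ⟨c, hc⟩ := block_embed_of_disjoint hX hY hd A σ τ
  rw [block_extend, hc, map_smul, hΦ, smul_zero, map_zero]

variable [∀ x, Fintype (ι x)]

theorem embed_mul (h : X ⊆ Λ) (A B : LocalAlg ι X) : embed h (A * B) = embed h A * embed h B := by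
  rw [embed_eq_submatrix, embed_eq_submatrix, embed_eq_submatrix, Matrix.submatrix_mul_equiv,
    ← Matrix.mul_kronecker_mul, one_mul]

theorem norm_embed_le (h : X ⊆ Λ) (A : LocalAlg ι X) : ‖embed h A‖ ≤ ‖A‖ := by
  rw [embed_eq_submatrix]
  exact (norm_reindex (Config.split h).symm _).trans_le (norm_kronecker_one_le A)

theorem embed_mul_apply (h : X ⊆ Λ) (A : LocalAlg ι X) (M : LocalAlg ι Λ) (σ τ : Config ι Λ) :
    (embed h A * M) σ τ = ∑ c, A (σ.restrict h) c * M (c.glue σ) τ := by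
  rw [Matrix.mul_apply, ← (Config.split h).symm.sum_comp, Fintype.sum_prod_type]
  refine Finset.sum_congr rfl fun c _ => ?_
  simp only [embed_eq_submatrix, Matrix.submatrix_apply, Equiv.apply_symm_apply,
    Matrix.kroneckerMap_apply, Matrix.one_apply, mul_ite, mul_one, mul_zero, ite_mul, zero_mul,
    Finset.sum_ite_eq, Finset.mem_univ, if_true, Config.glue_eq_split_symm h]
  simp only [Config.split, Equiv.coe_fn_mk]

theorem block_embed_mul (h : X ⊆ Λ) (A : LocalAlg ι X) (M : LocalAlg ι Λ) (σ τ : Config ι Λ) :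
    block X σ τ (embed h A * M) = A * block X σ τ M := by
  ext a b
  rw [block_apply, embed_mul_apply, Matrix.mul_apply]
  simp only [block_apply, Config.restrict_glue, Config.glue_glue]

theorem block_mul_embed (h : X ⊆ Λ) (A : LocalAlg ι X) (M : LocalAlg ι Λ) (σ τ : Config ι Λ) :
    block X σ τ (M * embed h A) = block X σ τ M * A := by
  apply Matrix.conjTranspose_injective
  rw [← block_conjTranspose, Matrix.conjTranspose_mul, embed_conjTranspose, block_embed_mul,
    Matrix.conjTranspose_mul, block_conjTranspose]

theorem embed_commute (hX : X ⊆ Λ) (hY : Y ⊆ Λ) (hd : Disjoint X Y) (A : LocalAlg ι X)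
    (B : LocalAlg ι Y) : Commute (embed hX A) (embed hY B) := by
  refine ext_block hY fun σ τ => ?_
  obtain ⟨c, hc⟩ := block_embed_of_disjoint hX hY hd A σ τ
  rw [block_mul_embed, block_embed_mul, hc, smul_one_mul, mul_smul_one]

end Embed

theorem exists_eq_sum_mul_mul {m : Type*} [Fintype m]
    (Φ : Matrix m m ℂ →ₗ[ℂ] Matrix m m ℂ) :
    ∃ P Q : m × m × m → Matrix m m ℂ, ∀ N, Φ N = ∑ i, P i * N * Q i := by
  classical
  refine ⟨fun i => Matrix.single i.2.2 i.1 1,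
    fun i => Matrix.single i.2.1 i.2.2 1 * Φ (Matrix.single i.1 i.2.1 1), fun N => ?_⟩
  have hunit (a b : m) (B : Matrix m m ℂ) :
      ∑ c, Matrix.single c a 1 * N * (Matrix.single b c 1 * B) = N a b • B := by
    simp only [← mul_assoc, Matrix.single_mul_mul_single, one_mul, mul_one]
    rw [← Finset.sum_mul, Matrix.sum_single_eq_diagonal, ← Matrix.smul_eq_diagonal_mul]
  calc Φ N = ∑ a, ∑ b, N a b • Φ (Matrix.single a b 1) := by
        conv_lhs => rw [Matrix.matrix_eq_sum_single N]
        simp only [map_sum, ← map_smul, Matrix.smul_single, smul_eq_mul, mul_one]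
    _ = _ := by simp only [Fintype.sum_prod_type, hunit]

section Extend

variable [∀ x, Fintype (ι x)] [∀ x, DecidableEq (ι x)]

omit [∀ x, DecidableEq (ι x)] in
theorem IsLindblad.extend (h : Z ⊆ Λ) {Φ : LocalAlg ι Z →ₗ[ℂ] LocalAlg ι Z}
    (hΦ : IsLindblad Φ) : IsLindblad (extend h Φ) := by
  classical
  obtain ⟨H, l, K, hH, hΦ⟩ := hΦ
  refine ⟨embed h H, l, fun j => embed h (K j), ?_, fun M => ext_block h fun σ τ => ?_⟩
  · rw [Matrix.IsHermitian, embed_conjTranspose, hH.eq]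
  · simp only [block_extend, hΦ, map_add, map_sub, map_smul, map_sum, embed_conjTranspose,
      ← embed_mul, block_embed_mul, block_mul_embed]

theorem extend_eq_sum (h : Z ⊆ Λ) {Φ : LocalAlg ι Z →ₗ[ℂ] LocalAlg ι Z} {I : Type*} [Fintype I]
    {P Q : I → LocalAlg ι Z} (hΦ : ∀ N, Φ N = ∑ i, P i * N * Q i) (M : LocalAlg ι Λ) :
    extend h Φ M = ∑ i, embed h (P i) * M * embed h (Q i) :=
  ext_block h fun σ τ => by
    simp only [block_extend, hΦ, map_sum, block_mul_embed, block_embed_mul]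

omit [∀ x, Fintype (ι x)] [∀ x, DecidableEq (ι x)] in
theorem extend_comm [∀ x, Finite (ι x)] (hX : X ⊆ Λ) (hY : Y ⊆ Λ) (hd : Disjoint X Y)
    (Φ : LocalAlg ι X →ₗ[ℂ] LocalAlg ι X) (Ψ : LocalAlg ι Y →ₗ[ℂ] LocalAlg ι Y)
    (M : LocalAlg ι Λ) : extend hX Φ (extend hY Ψ M) = extend hY Ψ (extend hX Φ M) := by
  classical
  have (x : Γ) : Fintype (ι x) := Fintype.ofFinite (ι x)
  obtain ⟨P, Q, hΦ⟩ := exists_eq_sum_mul_mul Φ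
  obtain ⟨R, S, hΨ⟩ := exists_eq_sum_mul_mul Ψ
  have hcomm (A : LocalAlg ι X) (B : LocalAlg ι Y) := embed_commute hX hY hd A B
  simp only [extend_eq_sum hX hΦ, extend_eq_sum hY hΨ, Finset.mul_sum, Finset.sum_mul]
  rw [Finset.sum_comm]
  refine Finset.sum_congr rfl fun j _ => Finset.sum_congr rfl fun i _ => ?_
  calc embed hX (P i) * (embed hY (R j) * M * embed hY (S j)) * embed hX (Q i)
      = (embed hX (P i) * embed hY (R j)) * M * (embed hY (S j) * embed hX (Q i)) := by
        simp only [mul_assoc]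
    _ = (embed hY (R j) * embed hX (P i)) * M * (embed hX (Q i) * embed hY (S j)) := by
        rw [hcomm, hcomm]
    _ = embed hY (R j) * (embed hX (P i) * M * embed hX (Q i)) * embed hY (S j) := by
        simp only [mul_assoc]

theorem norm_extend_le (h : Z ⊆ Λ) {Φ : LocalAlg ι Z →ₗ[ℂ] LocalAlg ι Z} (hΦ : cbNorm Φ < ∞)
    (M : LocalAlg ι Λ) : ‖extend h Φ M‖ ≤ (cbNorm Φ).toReal * ‖M‖ := by
  let e : Config ι Λ ≃ Config ι Z × Fin (Fintype.card (Config ι (Λ \ Z))) :=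
    (Config.split h).trans ((Equiv.refl _).prodCongr (Fintype.equivFin _))
  have hblock (p q) : block Z (e.symm p) (e.symm q) M
      = Matrix.of fun a b => M.reindex e e (a, p.2) (b, q.2) := by
    ext a b
    simp [block_apply, e, Config.glue_split_symm]
  have he : (extend h Φ M).reindex e e = ampliation _ Φ (M.reindex e e) := by
    ext p q
    change Φ (block Z (e.symm p) (e.symm q) M) ((e.symm p).restrict h) ((e.symm q).restrict h) = _
    have hres (p) : (e.symm p).restrict h = p.1 := congrArg Prod.fst (e.apply_symm_apply p)
    rw [hres, hres, hblock]
    rfl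
  rw [← norm_reindex e, he, ← norm_reindex e M]
  exact norm_ampliation_le hΦ _ _

end Extend

end Local

/-! ### Power laws on regular metric spaces -/

section Metric

theorem powerLaw_pos (α : ℝ) {r : ℝ} (hr : 0 ≤ r) : 0 < powerLaw α r := by
  unfold powerLaw
  positivity

theorem powerLaw_anti {α : ℝ} (hα : 0 ≤ α) {r s : ℝ} (hr : 0 ≤ r) (hrs : r ≤ s) :
    powerLaw α s ≤ powerLaw α r := by
  unfold powerLaw
  gcongr

theorem powerLaw_add (α β : ℝ) {r : ℝ} (hr : 0 ≤ r) :
    powerLaw (α + β) r = powerLaw α r * powerLaw β r := by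
  unfold powerLaw
  rw [Real.rpow_add (by positivity), one_div_mul_one_div]

theorem powerLaw_le_two_rpow_mul {α : ℝ} (hα : 0 ≤ α) {r s : ℝ} (hr : 0 ≤ r)
    (hrs : r / 2 ≤ s) : powerLaw α s ≤ 2 ^ α * powerLaw α r := by
  have hs : 0 ≤ s := (div_nonneg hr zero_le_two).trans hrs
  unfold powerLaw
  rw [mul_one_div, div_le_div_iff₀ (by positivity) (by positivity), one_mul,
    ← Real.mul_rpow zero_le_two (by positivity)]
  exact Real.rpow_le_rpow (by positivity) (by linarith) hα

theorem powerLaw_le_powerLaw {α β r : ℝ} (hαβ : α ≤ β) (hr : 0 ≤ r) :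
    powerLaw β r ≤ powerLaw α r := by
  unfold powerLaw
  gcongr
  linarith

theorem powerLaw_mul_rpow (α ν : ℝ) {r : ℝ} (hr : 0 ≤ r) :
    powerLaw α r * (1 + r) ^ ν = powerLaw (α - ν) r := by
  unfold powerLaw
  rw [Real.rpow_sub (by positivity), one_div_div, one_div_mul_eq_div]

theorem powerLaw_le_rpow {α ν r : ℝ} (hα : 0 ≤ α) (hν : 0 ≤ ν) (hr : 0 ≤ r) :
    powerLaw α r ≤ (1 + r) ^ ν :=
  calc powerLaw α r ≤ powerLaw 0 r := powerLaw_le_powerLaw hα hr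
    _ = 1 := by simp [powerLaw]
    _ ≤ (1 + r) ^ ν := Real.one_le_rpow (by linarith) hν

theorem powerLaw_rpow_le {α θ r : ℝ} (hα : 0 ≤ α) (hθ : 0 ≤ θ) (hθ' : θ ≤ 1) (hr : 0 ≤ r) :
    powerLaw α (r ^ θ) ≤ powerLaw (θ * α) r := by
  unfold powerLaw
  rw [Real.rpow_mul (by positivity)]
  gcongr
  simpa using Real.rpow_add_le_add_rpow zero_le_one hr hθ hθ'

theorem summable_powerLaw_nat {α : ℝ} (hα : 1 < α) : Summable fun n : ℕ => powerLaw α n := by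
  refine ((summable_nat_add_iff 1).2 (Real.summable_one_div_nat_rpow.2 hα)).congr fun n => ?_
  rw [powerLaw, Nat.cast_succ, add_comm]

/-- The sums of `F (d(x, y))` over points `y` at distance at least `r` from `x` are bounded
by `B`, uniformly in `x`. -/
def HasTailBound (Γ : Type*) [MetricSpace Γ] (F : ℝ → ℝ) (r B : ℝ) : Prop :=
  ∀ (x : Γ) (s : Finset Γ), (∀ y ∈ s, r ≤ dist x y) → ∑ y ∈ s, F (dist x y) ≤ B

/-- The open balls of radius `d` have at most `N` points. -/
def HasBallBound (Γ : Type*) [MetricSpace Γ] (d N : ℝ) : Prop :=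
  ∀ (x : Γ) (s : Finset Γ), (∀ y ∈ s, dist x y < d) → (s.card : ℝ) ≤ N

/-- The real-valued form of the inequality defining the convolution constant `C_F`. -/
def HasConvolutionBound (Γ : Type*) [MetricSpace Γ] (F : ℝ → ℝ) (C : ℝ) : Prop :=
  ∀ (x y : Γ) (s : Finset Γ), ∑ z ∈ s, F (dist x z) * F (dist z y) ≤ C * F (dist x y)

variable {Γ : Type*} [MetricSpace Γ]

theorem HasBallBound.nonneg {d N : ℝ} (h : HasBallBound Γ d N) (x : Γ) : 0 ≤ N := by
  simpa using h x ∅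

theorem HasTailBound.nonneg {F : ℝ → ℝ} {r B : ℝ} (h : HasTailBound Γ F r B) (x : Γ) :
    0 ≤ B := by
  simpa using h x ∅

theorem HasTailBound.sum_sum_le {F : ℝ → ℝ} {r B : ℝ} (h : HasTailBound Γ F r B)
    {X Y : Finset Γ} (hXY : ∀ x ∈ X, ∀ y ∈ Y, r ≤ dist x y) :
    ∑ y ∈ Y, ∑ x ∈ X, F (dist x y) ≤ X.card * B := by
  rw [Finset.sum_comm, ← nsmul_eq_mul]
  exact Finset.sum_le_card_nsmul _ _ _ fun x hx => h x Y (hXY x hx)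

theorem HasConvolutionBound.pos {F : ℝ → ℝ} {C : ℝ} (h : HasConvolutionBound Γ F C)
    (hF : ∀ r, 0 ≤ r → 0 < F r) (x : Γ) : 0 < C := by
  have h0 := hF (dist x x) dist_nonneg
  have hx := h x x {x}
  rw [Finset.sum_singleton] at hx
  exact pos_of_mul_pos_left ((mul_pos h0 h0).trans_le hx) h0.le

theorem IsRegular.card_le {κ ν : ℝ} (h : IsRegular Γ κ ν) (x : Γ) (n : ℕ) (s : Finset Γ)
    (hs : ∀ y ∈ s, dist x y ≤ n + 1) : (s.card : ℝ) ≤ κ * ((n : ℝ) + 1) ^ ν := by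
  refine le_trans ?_ (h x n).2
  rw [← Set.ncard_coe_finset]
  refine Nat.cast_le.2 (Set.ncard_le_ncard (fun y hy => ?_) (h x n).1)
  rw [Metric.mem_closedBall, dist_comm]
  exact hs y hy

theorem IsRegular.nonneg {κ ν : ℝ} (h : IsRegular Γ κ ν) (x : Γ) : 0 ≤ κ := by
  simpa using h.card_le x 0 ∅

theorem IsRegular.hasBallBound {κ ν : ℝ} (h : IsRegular Γ κ ν) (hν : 0 ≤ ν) {d : ℝ}
    (hd : 0 ≤ d) : HasBallBound Γ d (κ * (1 + d) ^ ν) := fun x s hs => by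
  have hκ := h.nonneg x
  calc (s.card : ℝ) ≤ κ * ((⌊d⌋₊ : ℝ) + 1) ^ ν :=
        h.card_le x ⌊d⌋₊ s fun y hy => (hs y hy).le.trans (Nat.lt_floor_add_one d).le
    _ ≤ κ * (d + 1) ^ ν := by
        gcongr
        exact Nat.floor_le hd
    _ = κ * (1 + d) ^ ν := by rw [add_comm]

theorem IsRegular.sum_powerLaw_shell_le {κ ν β : ℝ} (h : IsRegular Γ κ ν) (hνβ : 0 ≤ ν + β)
    (x : Γ) (n : ℕ) (s : Finset Γ) (hs : ∀ y ∈ s, ⌊dist x y⌋₊ = n) :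
    ∑ y ∈ s, powerLaw (ν + β) (dist x y) ≤ κ * powerLaw β n := by
  have hn : (0 : ℝ) ≤ n := Nat.cast_nonneg n
  calc ∑ y ∈ s, powerLaw (ν + β) (dist x y) ≤ s.card • powerLaw (ν + β) n :=
        Finset.sum_le_card_nsmul _ _ _ fun y hy =>
          powerLaw_anti hνβ hn (hs y hy ▸ Nat.floor_le dist_nonneg)
    _ = s.card * powerLaw (ν + β) n := nsmul_eq_mul _ _
    _ ≤ κ * ((n : ℝ) + 1) ^ ν * powerLaw (ν + β) n :=
        mul_le_mul_of_nonneg_right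
          (h.card_le x n s fun y hy => (hs y hy ▸ Nat.lt_floor_add_one (dist x y)).le)
          (powerLaw_pos _ hn).le
    _ = κ * powerLaw β n := by
        have : (0 : ℝ) < (1 + (n : ℝ)) ^ ν := by positivity
        rw [powerLaw_add _ _ hn, powerLaw, add_comm (n : ℝ) 1]
        field_simp

theorem IsRegular.sum_powerLaw_le {κ ν β : ℝ} (h : IsRegular Γ κ ν) (hνβ : 0 ≤ ν + β)
    (hβ : 1 < β) (x : Γ) (s : Finset Γ) :
    ∑ y ∈ s, powerLaw (ν + β) (dist x y) ≤ κ * ∑' n : ℕ, powerLaw β n := by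
  have hκ := h.nonneg x
  calc ∑ y ∈ s, powerLaw (ν + β) (dist x y)
      = ∑ n ∈ s.image fun y => ⌊dist x y⌋₊,
          ∑ y ∈ s with ⌊dist x y⌋₊ = n, powerLaw (ν + β) (dist x y) :=
        (Finset.sum_fiberwise_of_maps_to (fun _ => Finset.mem_image_of_mem _) _).symm
    _ ≤ ∑ n ∈ s.image fun y => ⌊dist x y⌋₊, κ * powerLaw β n :=
        Finset.sum_le_sum fun n _ => h.sum_powerLaw_shell_le hνβ x n _
          fun y hy => (Finset.mem_filter.1 hy).2
    _ = κ * ∑ n ∈ s.image fun y => ⌊dist x y⌋₊, powerLaw β n := (Finset.mul_sum ..).symm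
    _ ≤ κ * ∑' n : ℕ, powerLaw β n := by
        gcongr
        exact (summable_powerLaw_nat hβ).sum_le_tsum _ fun n _ =>
          (powerLaw_pos β n.cast_nonneg).le

theorem IsRegular.hasTailBound_powerLaw {κ ν β γ : ℝ} (h : IsRegular Γ κ ν)
    (hνβ : 0 ≤ ν + β) (hβ : 1 < β) (hγ : 0 ≤ γ) {r : ℝ} (hr : 0 ≤ r) :
    HasTailBound Γ (powerLaw (γ + (ν + β))) r
      (κ * (∑' n : ℕ, powerLaw β n) * powerLaw γ r) := fun x s hs =>
  calc ∑ y ∈ s, powerLaw (γ + (ν + β)) (dist x y)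
      ≤ ∑ y ∈ s, powerLaw (ν + β) (dist x y) * powerLaw γ r := by
        refine Finset.sum_le_sum fun y hy => ?_
        rw [powerLaw_add _ _ dist_nonneg, mul_comm]
        exact mul_le_mul_of_nonneg_left (powerLaw_anti hγ hr (hs y hy))
          (powerLaw_pos _ dist_nonneg).le
    _ = (∑ y ∈ s, powerLaw (ν + β) (dist x y)) * powerLaw γ r := (Finset.sum_mul ..).symm
    _ ≤ κ * (∑' n : ℕ, powerLaw β n) * powerLaw γ r :=
        mul_le_mul_of_nonneg_right (h.sum_powerLaw_le hνβ hβ x s) (powerLaw_pos γ hr).le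

theorem powerLaw_dist_mul_powerLaw_dist_le {α : ℝ} (hα : 0 ≤ α) (x y z : Γ) :
    powerLaw α (dist x z) * powerLaw α (dist z y)
      ≤ 2 ^ α * (powerLaw α (dist x z) + powerLaw α (dist y z)) * powerLaw α (dist x y) := by
  have hxz := (powerLaw_pos α (dist_nonneg (x := x) (y := z))).le
  have hyz := (powerLaw_pos α (dist_nonneg (x := y) (y := z))).le
  have hxy := (powerLaw_pos α (dist_nonneg (x := x) (y := y))).le
  have htri := dist_triangle_right x y z
  -- One of `x`, `y` is at distance at least `d(x, y) / 2` from `z`.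
  have hfar : powerLaw α (dist x z) ≤ 2 ^ α * powerLaw α (dist x y) ∨
      powerLaw α (dist y z) ≤ 2 ^ α * powerLaw α (dist x y) :=
    (le_total (dist y z) (dist x z)).imp
      (fun hle => powerLaw_le_two_rpow_mul hα dist_nonneg (by linarith))
      (fun hle => powerLaw_le_two_rpow_mul hα dist_nonneg (by linarith))
  rw [dist_comm z y]
  have hp : (0 : ℝ) ≤ 2 ^ α * powerLaw α (dist x y) := by positivity
  rcases hfar with h | h
  · nlinarith [mul_le_mul_of_nonneg_right h hyz]
  · nlinarith [mul_le_mul_of_nonneg_left h hxz]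

theorem HasTailBound.hasConvolutionBound_powerLaw {α B : ℝ}
    (h : HasTailBound Γ (powerLaw α) 0 B) (hα : 0 ≤ α) :
    HasConvolutionBound Γ (powerLaw α) (2 ^ α * (B + B)) := fun x y s => by
  have hsum : ∀ x : Γ, ∑ z ∈ s, powerLaw α (dist x z) ≤ B := fun x =>
    h x s fun _ _ => dist_nonneg
  calc ∑ z ∈ s, powerLaw α (dist x z) * powerLaw α (dist z y)
      ≤ ∑ z ∈ s, 2 ^ α * (powerLaw α (dist x z) + powerLaw α (dist y z))
          * powerLaw α (dist x y) :=
        Finset.sum_le_sum fun z _ => powerLaw_dist_mul_powerLaw_dist_le hα x y z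
    _ = 2 ^ α * (∑ z ∈ s, powerLaw α (dist x z) + ∑ z ∈ s, powerLaw α (dist y z))
          * powerLaw α (dist x y) := by
        rw [← Finset.sum_mul, ← Finset.mul_sum, Finset.sum_add_distrib]
    _ ≤ 2 ^ α * (B + B) * powerLaw α (dist x y) :=
        mul_le_mul_of_nonneg_right
          (mul_le_mul_of_nonneg_left (add_le_add (hsum x) (hsum y)) (by positivity))
          (powerLaw_pos α dist_nonneg).le

end Metric

/-! ### The constants defined as infima -/

section Constants

theorem le_sInf_mul {I : Type*} {a b : I → ℝ≥0∞} (hb : ∀ i, b i ≠ 0) (hb' : ∀ i, b i ≠ ∞)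
    (i : I) : a i ≤ sInf {C : ℝ≥0∞ | ∀ i, a i ≤ C * b i} * b i := by
  rw [← ENNReal.div_le_iff (hb i) (hb' i)]
  exact le_sInf fun C hC => (ENNReal.div_le_iff (hb i) (hb' i)).2 (hC i)

variable {Γ : Type*} [MetricSpace Γ] {F : ℝ → ℝ}

theorem HasConvolutionBound.convConst_lt_top {C : ℝ} (h : HasConvolutionBound Γ F C)
    (hF : ∀ r, 0 ≤ r → 0 ≤ F r) : convConst Γ F < ∞ := by
  refine lt_of_le_of_lt (sInf_le (a := ENNReal.ofReal C) fun x y => ?_) ENNReal.ofReal_lt_top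
  rw [ENNReal.tsum_eq_iSup_sum, ← ENNReal.ofReal_mul' (hF _ dist_nonneg)]
  refine iSup_le fun s => ?_
  simp only [← ENNReal.ofReal_mul (hF _ dist_nonneg)]
  rw [← ENNReal.ofReal_sum_of_nonneg fun z _ =>
    mul_nonneg (hF _ dist_nonneg) (hF _ dist_nonneg)]
  exact ENNReal.ofReal_le_ofReal (h x y s)

theorem hasConvolutionBound_convConst (hF : ∀ r, 0 ≤ r → 0 < F r) (hC : convConst Γ F < ∞) :
    HasConvolutionBound Γ F (convConst Γ F).toReal := fun x y s => by
  have hpos : ∀ x y : Γ, 0 ≤ F (dist x y) := fun x y => (hF _ dist_nonneg).le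
  have hsum : ∑ z ∈ s, ENNReal.ofReal (F (dist x z)) * ENNReal.ofReal (F (dist z y))
      ≤ convConst Γ F * ENNReal.ofReal (F (dist x y)) := by
    have h := le_sInf_mul (I := Γ × Γ)
      (a := fun p => ∑' z, ENNReal.ofReal (F (dist p.1 z)) * ENNReal.ofReal (F (dist z p.2)))
      (b := fun p => ENNReal.ofReal (F (dist p.1 p.2)))
      (fun p => (ENNReal.ofReal_pos.2 (hF _ dist_nonneg)).ne')
      (fun p => ENNReal.ofReal_ne_top) (x, y)
    simp only [Prod.forall] at h
    exact (ENNReal.sum_le_tsum s).trans h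
  simpa [ENNReal.toReal_sum, ENNReal.mul_ne_top, ENNReal.toReal_mul, hpos] using
    ENNReal.toReal_mono (ENNReal.mul_ne_top hC.ne ENNReal.ofReal_ne_top) hsum

theorem IsRegular.convConst_powerLaw_lt_top {κ ν β γ : ℝ} (h : IsRegular Γ κ ν)
    (hνβ : 0 ≤ ν + β) (hβ : 1 < β) (hγ : 0 ≤ γ) :
    convConst Γ (powerLaw (γ + (ν + β))) < ∞ :=
  ((h.hasTailBound_powerLaw hνβ hβ hγ le_rfl).hasConvolutionBound_powerLaw
    (add_nonneg hγ hνβ)).convConst_lt_top fun _ hr => (powerLaw_pos _ hr).le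

variable [DecidableEq Γ] {ι : Γ → Type*} [∀ x, Fintype (ι x)] [∀ x, DecidableEq (ι x)]

theorem Interaction.sum_cbNorm_le (L : Interaction ι) (hF : ∀ r, 0 ≤ r → 0 < F r) (x y : Γ)
    (s : Finset (Finset Γ)) (hs : ∀ Z ∈ s, x ∈ Z ∧ y ∈ Z) :
    ∑ Z ∈ s, cbNorm (L.term Z) ≤ L.fNorm F * ENNReal.ofReal (F (dist x y)) := by
  have h := le_sInf_mul (I := Γ × Γ)
    (a := fun p => ∑' Z : {Z : Finset Γ // p.1 ∈ Z ∧ p.2 ∈ Z}, cbNorm (L.term Z.1))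
    (b := fun p => ENNReal.ofReal (F (dist p.1 p.2)))
    (fun p => (ENNReal.ofReal_pos.2 (hF _ dist_nonneg)).ne')
    (fun p => ENNReal.ofReal_ne_top) (x, y)
  simp only [Prod.forall] at h
  rw [← Finset.sum_subtype_of_mem (fun Z => cbNorm (L.term Z)) hs]
  exact (ENNReal.sum_le_tsum _).trans h

theorem Interaction.cbNorm_term_lt_top (L : Interaction ι) (hF : ∀ r, 0 ≤ r → 0 < F r)
    (hL : L.fNorm F < ∞) {Z : Finset Γ} (hZ : Z.Nonempty) : cbNorm (L.term Z) < ∞ := by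
  obtain ⟨x, hx⟩ := hZ
  have h := L.sum_cbNorm_le hF x x {Z} (by simpa using hx)
  rw [Finset.sum_singleton] at h
  exact h.trans_lt (ENNReal.mul_lt_top hL ENNReal.ofReal_lt_top)

theorem Interaction.sum_cbNorm_toReal_le (L : Interaction ι) (hF : ∀ r, 0 ≤ r → 0 < F r)
    (hL : L.fNorm F < ∞) (x y : Γ) (s : Finset (Finset Γ)) (hs : ∀ Z ∈ s, x ∈ Z ∧ y ∈ Z) :
    ∑ Z ∈ s, (cbNorm (L.term Z)).toReal ≤ (L.fNorm F).toReal * F (dist x y) := by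
  have h := ENNReal.toReal_mono (ENNReal.mul_lt_top hL ENNReal.ofReal_lt_top).ne
    (L.sum_cbNorm_le hF x y s hs)
  rwa [ENNReal.toReal_sum fun Z hZ => (L.cbNorm_term_lt_top hF hL ⟨x, (hs Z hZ).1⟩).ne,
    ENNReal.toReal_mul, ENNReal.toReal_ofReal (hF _ dist_nonneg).le] at h

end Constants

/-! ### Sums over families of finite sets -/

section Families

variable {Γ : Type*} [DecidableEq Γ]

theorem sum_mul_sum_le (T : Finset (Finset Γ)) {w : Finset Γ → ℝ} {u b : Γ → ℝ}
    (hu : ∀ z, 0 ≤ u z) (hb : ∀ z, ∑ Z ∈ T with z ∈ Z, w Z ≤ b z) :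
    ∑ Z ∈ T, w Z * ∑ z ∈ Z, u z ≤ ∑ z ∈ T.biUnion id, u z * b z := by
  have hswap : ∑ Z ∈ T, w Z * ∑ z ∈ Z, u z
      = ∑ z ∈ T.biUnion id, u z * ∑ Z ∈ T with z ∈ Z, w Z := by
    simp only [Finset.mul_sum]
    rw [Finset.sum_comm' (t' := T.biUnion id) (s' := fun z => {Z ∈ T | z ∈ Z}) fun Z z => ?_]
    · simp only [mul_comm]
    · simp only [Finset.mem_filter, Finset.mem_biUnion, id]
      exact ⟨fun h => ⟨h, Z, h⟩, fun h => h.1⟩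
  rw [hswap]
  exact Finset.sum_le_sum fun z _ => mul_le_mul_of_nonneg_left (hb z) (hu z)

theorem sum_not_disjoint_le (T : Finset (Finset Γ)) (Y : Finset Γ) {f : Finset Γ → ℝ}
    (hf : ∀ Z, 0 ≤ f Z) :
    ∑ Z ∈ T with ¬ Disjoint Z Y, f Z ≤ ∑ y ∈ Y, ∑ Z ∈ T with y ∈ Z, f Z := by
  simp only [Finset.sum_filter]
  rw [Finset.sum_comm]
  refine Finset.sum_le_sum fun Z _ => ?_
  have hterm : ∀ y ∈ Y, 0 ≤ if y ∈ Z then f Z else 0 := fun y _ => by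
    split_ifs
    exacts [hf Z, le_rfl]
  split_ifs with hd
  · exact Finset.sum_nonneg hterm
  · obtain ⟨y, hyZ, hyY⟩ := Finset.not_disjoint_iff.1 hd
    exact (if_pos hyZ).ge.trans (Finset.single_le_sum hterm hyY)

end Families

/-! ### The Lieb–Robinson iteration -/

/-- The features of a finite-volume dissipative generator that enter the Lieb–Robinson
argument: finitely many bounded terms labelled by finite sets of sites, every partial sum of
which generates a contraction semigroup, and which commute when their labels are disjoint. -/
structure DissipativeFamily (Γ E : Type*) [NormedAddCommGroup E] [NormedSpace ℂ E] where
  /-- the labels of the terms -/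
  support : Finset (Finset Γ)
  /-- the term with a given label -/
  term : Finset Γ → E →L[ℂ] E
  norm_flow_sum_le_one : ∀ S ⊆ support, ∀ t : ℝ, 0 ≤ t → ‖flow (∑ Z ∈ S, term Z) t‖ ≤ 1
  commute : ∀ Z ∈ support, ∀ Z' ∈ support, Disjoint Z Z' → Commute (term Z) (term Z')

namespace DissipativeFamily

section Basic

variable {Γ E : Type*} [NormedAddCommGroup E] [NormedSpace ℂ E] (D : DissipativeFamily Γ E)

/-- The sum of all terms. -/
def generator : E →L[ℂ] E :=
  ∑ Z ∈ D.support, D.term Z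

/-- The subfamily of the terms whose labels satisfy `p`. -/
def restrict (p : Finset Γ → Prop) [DecidablePred p] : DissipativeFamily Γ E where
  support := {Z ∈ D.support | p Z}
  term := D.term
  norm_flow_sum_le_one S hS := D.norm_flow_sum_le_one S (hS.trans (Finset.filter_subset _ _))
  commute Z hZ Z' hZ' := D.commute Z (Finset.mem_filter.1 hZ).1 Z' (Finset.mem_filter.1 hZ').1

theorem generator_restrict_add_not (p : Finset Γ → Prop) [DecidablePred p] :
    (D.restrict p).generator + (D.restrict fun Z => ¬ p Z).generator = D.generator :=
  Finset.sum_filter_add_sum_filter_not _ _ _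

theorem norm_flow_apply_le {t : ℝ} (ht : 0 ≤ t) (A : E) : ‖flow D.generator t A‖ ≤ ‖A‖ :=
  (ContinuousLinearMap.le_of_opNorm_le _
    (D.norm_flow_sum_le_one _ subset_rfl t ht) A).trans_eq (one_mul _)

theorem norm_generator_apply_le (A : E) :
    ‖D.generator A‖ ≤ ∑ Z ∈ D.support, ‖D.term Z A‖ := by
  rw [generator, sum_apply]
  exact norm_sum_le _ _

/-- `A` behaves like an observable supported on `X`. -/
def IsObservable (X : Finset Γ) (A : E) : Prop :=
  ∀ Z ∈ D.support, Disjoint X Z → D.term Z A = 0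

/-- `k` behaves like an operation acting on the sites of `Y` only. -/
def ActsOn (Y : Finset Γ) (k : E →L[ℂ] E) : Prop :=
  ∀ Z ∈ D.support, Disjoint Z Y → Commute (D.term Z) k

variable {D}

theorem IsObservable.restrict {X : Finset Γ} {A : E} (hA : D.IsObservable X A)
    (p : Finset Γ → Prop) [DecidablePred p] : (D.restrict p).IsObservable X A :=
  fun Z hZ => hA Z (Finset.mem_filter.1 hZ).1

theorem ActsOn.restrict {Y : Finset Γ} {k : E →L[ℂ] E} (hk : D.ActsOn Y k)
    (p : Finset Γ → Prop) [DecidablePred p] : (D.restrict p).ActsOn Y k :=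
  fun Z hZ => hk Z (Finset.mem_filter.1 hZ).1

theorem actsOn_term {Z : Finset Γ} (hZ : Z ∈ D.support) : D.ActsOn Z (D.term Z) :=
  fun Z' hZ' hd => D.commute Z' hZ' Z hZ hd

theorem ActsOn.commute_generator [DecidableEq Γ] {Y : Finset Γ} {k : E →L[ℂ] E}
    (hk : D.ActsOn Y k) : Commute (D.restrict fun Z => Disjoint Z Y).generator k :=
  Commute.sum_left _ _ _ fun Z hZ => hk Z (Finset.mem_filter.1 hZ).1 (Finset.mem_filter.1 hZ).2

variable (D)

/-- `V Y t` bounds the effect at time `t` on the sites of `Y` of an observable `A` that is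
initially supported on `X`. -/
def PropagationBound (X : Finset Γ) (A : E) (V : Finset Γ → ℝ → ℝ) : Prop :=
  ∀ (Y : Finset Γ) (k : E →L[ℂ] E), D.ActsOn Y k → (Disjoint X Y → k A = 0) →
    ∀ t : ℝ, 0 ≤ t → ‖k (flow D.generator t A)‖ ≤ ‖k‖ * (‖A‖ * V Y t)

/-- `U`, with time derivative `U'`, dominates the bound obtained by inserting the propagation
bound `V` for the terms that touch `Y` into Duhamel's formula. -/
structure Dominates [DecidableEq Γ] (X : Finset Γ) (V U U' : Finset Γ → ℝ → ℝ) : Prop where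
  hasDerivAt : ∀ Y s, HasDerivAt (U Y) (U' Y s) s
  nonneg_zero : ∀ Y, 0 ≤ U Y 0
  one_le_zero : ∀ Y, ¬ Disjoint X Y → 1 ≤ U Y 0
  sum_le : ∀ Y (s : ℝ), 0 ≤ s → ∑ Z ∈ D.support with ¬ Disjoint Z Y, ‖D.term Z‖ * V Z s ≤ U' Y s

end Basic

section Iteration

variable {Γ E : Type*} [DecidableEq Γ] [NormedAddCommGroup E] [NormedSpace ℂ E]
  {D : DissipativeFamily Γ E} {X : Finset Γ} {A : E} {V U U' : Finset Γ → ℝ → ℝ}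

theorem Dominates.norm_apply_zero_le (hU : D.Dominates X V U U') {Y : Finset Γ}
    {k : E →L[ℂ] E} (hk : Disjoint X Y → k A = 0) : ‖k A‖ ≤ ‖k‖ * (‖A‖ * U Y 0) := by
  by_cases hd : Disjoint X Y
  · have := hU.nonneg_zero Y
    rw [hk hd, norm_zero]
    positivity
  · exact (k.le_opNorm A).trans (mul_le_mul_of_nonneg_left
      (le_mul_of_one_le_right (norm_nonneg A) (hU.one_le_zero Y hd)) (norm_nonneg k))

theorem PropagationBound.norm_generator_near_le (hV : D.PropagationBound X A V)
    (hA : D.IsObservable X A) (Y : Finset Γ) {s : ℝ} (hs : 0 ≤ s) :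
    ‖(D.restrict fun Z => ¬ Disjoint Z Y).generator (flow D.generator s A)‖
      ≤ ‖A‖ * ∑ Z ∈ D.support with ¬ Disjoint Z Y, ‖D.term Z‖ * V Z s := by
  refine (norm_generator_apply_le _ _).trans ?_
  rw [Finset.mul_sum]
  refine Finset.sum_le_sum fun Z hZ => ?_
  have hZD : Z ∈ D.support := (Finset.mem_filter.1 hZ).1
  exact (hV Z (D.term Z) (actsOn_term hZD) (hA Z hZD) s hs).trans_eq (mul_left_comm _ _ _)

variable [CompleteSpace E]

theorem PropagationBound.of_dominates (hV : D.PropagationBound X A V)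
    (hA : D.IsObservable X A) (hU : D.Dominates X V U U') : D.PropagationBound X A U := by
  intro Y k hk hkA t ht
  set far := D.restrict fun Z => Disjoint Z Y
  set near := D.restrict fun Z => ¬ Disjoint Z Y
  -- The terms away from `Y` commute with `k`, so only those touching `Y` contribute.
  have hderiv (s : ℝ) :
      HasDerivAt (fun s => flow far.generator (t - s) (k (flow D.generator s A)))
        (flow far.generator (t - s) (k (near.generator (flow D.generator s A)))) s := by
    rw [← D.generator_restrict_add_not fun Z => Disjoint Z Y]
    exact hasDerivAt_flow_sub_apply_flow_add hk.commute_generator A t s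
  have hbound := image_norm_le_of_norm_deriv_right_le_deriv_boundary
    (a := 0) (b := t) (B := fun s => ‖k‖ * (‖A‖ * U Y s))
    (B' := fun s => ‖k‖ * (‖A‖ * U' Y s))
    (fun s _ => (hderiv s).continuousAt.continuousWithinAt)
    (fun s _ => (hderiv s).hasDerivWithinAt) ?initial
    (fun s => ((hU.hasDerivAt Y s).const_mul _).const_mul _) ?slope (x := t) ⟨ht, le_rfl⟩
  case initial =>
    simp only [sub_zero, flow_zero, one_apply_eq_self]
    exact (far.norm_flow_apply_le ht _).trans (hU.norm_apply_zero_le hkA)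
  case slope =>
    rintro s ⟨hs, hst⟩
    calc ‖flow far.generator (t - s) (k (near.generator (flow D.generator s A)))‖
        ≤ ‖k (near.generator (flow D.generator s A))‖ :=
          far.norm_flow_apply_le (sub_nonneg.2 hst.le) _
      _ ≤ ‖k‖ * (‖A‖ * ∑ Z ∈ D.support with ¬ Disjoint Z Y, ‖D.term Z‖ * V Z s) :=
          k.le_opNorm_of_le (hV.norm_generator_near_le hA Y hs)
      _ ≤ ‖k‖ * (‖A‖ * U' Y s) := by
          gcongr
          exact hU.sum_le Y s hs
  simpa [flow_zero] using hbound

omit [DecidableEq Γ] [CompleteSpace E] in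
theorem propagationBound_of_one_le (hU : ∀ Y (t : ℝ), 0 ≤ t → 1 ≤ U Y t) :
    D.PropagationBound X A U := fun Y k _ _ t ht =>
  k.le_opNorm_of_le ((D.norm_flow_apply_le ht A).trans
    (le_mul_of_one_le_right (norm_nonneg A) (hU Y t ht)))

omit [CompleteSpace E] in
/-- The iteration improves a supersolution plus an error of order `n` to one of order `n + 1`. -/
theorem Dominates.add_pow_div_factorial (hU : D.Dominates X U U U') (n : ℕ) {W : ℝ}
    (hW : W = ∑ Z ∈ D.support, ‖D.term Z‖) :
    D.Dominates X (fun Y s => U Y s + (W * s) ^ n / n.factorial)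
      (fun Y s => U Y s + (W * s) ^ (n + 1) / (n + 1).factorial)
      (fun Y s => U' Y s + W * ((W * s) ^ n / n.factorial)) where
  hasDerivAt Y s := by
    have hlin : HasDerivAt (fun s : ℝ => W * s) W s := by
      simpa using (hasDerivAt_id s).const_mul W
    refine (hU.hasDerivAt Y s).add (((hlin.pow (n + 1)).div_const _).congr_deriv ?_)
    have hn : (n.factorial : ℝ) ≠ 0 := by positivity
    rw [Nat.factorial_succ]
    push_cast
    field_simp
  nonneg_zero Y := by simpa using hU.nonneg_zero Y
  one_le_zero Y hY := by simpa using hU.one_le_zero Y hY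
  sum_le Y s hs := by
    have hW0 : 0 ≤ W := hW ▸ Finset.sum_nonneg fun Z _ => norm_nonneg _
    have hnear : ∑ Z ∈ D.support with ¬ Disjoint Z Y, ‖D.term Z‖ ≤ W :=
      hW ▸ Finset.sum_le_sum_of_subset_of_nonneg (Finset.filter_subset _ _)
        fun Z _ _ => norm_nonneg _
    simp only [mul_add, Finset.sum_add_distrib, ← Finset.sum_mul]
    gcongr
    exact hU.sum_le Y s hs

theorem Dominates.propagationBound (hU : D.Dominates X U U U')
    (hU0 : ∀ Y (t : ℝ), 0 ≤ t → 0 ≤ U Y t) (hA : D.IsObservable X A) :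
    D.PropagationBound X A U := by
  set W := ∑ Z ∈ D.support, ‖D.term Z‖ with hW
  have hiter (n : ℕ) :
      D.PropagationBound X A fun Y s => U Y s + (W * s) ^ n / n.factorial := by
    induction n with
    | zero => exact propagationBound_of_one_le fun Y t ht => by simpa using hU0 Y t ht
    | succ n ih => exact ih.of_dominates hA (hU.add_pow_div_factorial n hW)
  intro Y k hk hkA t ht
  have hlim := (((FloorSemiring.tendsto_pow_div_factorial_atTop (W * t)).const_add
    (U Y t)).const_mul ‖A‖).const_mul ‖k‖
  rw [add_zero] at hlim
  exact ge_of_tendsto' hlim fun n => hiter n Y k hk hkA t ht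

end Iteration

end DissipativeFamily

/-! ### Lieb–Robinson bounds -/

section Kernel

variable {Γ : Type*} [MetricSpace Γ] {f : ℝ → ℝ} {M C s : ℝ}

section

variable [DecidableEq Γ]

/-- The contribution of the pair of sites `x`, `y` to the Lieb–Robinson bound at time `s`, for
the decay function `f` with convolution constant `C` and an interaction of strength `M`. -/
def lrKernel (f : ℝ → ℝ) (M C s : ℝ) (x y : Γ) : ℝ :=
  (if x = y then 1 else 0) + f (dist x y) * ((Real.exp (M * C * s) - 1) / C)

/-- The right-hand side of the Lieb–Robinson bound. -/
def lrBound (f : ℝ → ℝ) (M C : ℝ) (X Y : Finset Γ) (s : ℝ) : ℝ :=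
  ∑ y ∈ Y, ∑ x ∈ X, lrKernel f M C s x y

end

/-- The time derivative of `lrBound`. -/
def lrBoundDeriv (f : ℝ → ℝ) (M C : ℝ) (X Y : Finset Γ) (s : ℝ) : ℝ :=
  ∑ y ∈ Y, ∑ x ∈ X, M * f (dist x y) * Real.exp (M * C * s)

theorem exp_sub_one_div_nonneg (hM : 0 ≤ M) (hC : 0 ≤ C) (hs : 0 ≤ s) :
    0 ≤ (Real.exp (M * C * s) - 1) / C :=
  div_nonneg (sub_nonneg.2 (Real.one_le_exp (by positivity))) hC

variable [DecidableEq Γ]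

theorem hasDerivAt_lrBound (f : ℝ → ℝ) (M : ℝ) (hC : C ≠ 0) (X Y : Finset Γ) (s : ℝ) :
    HasDerivAt (lrBound f M C X Y) (lrBoundDeriv f M C X Y s) s := by
  refine HasDerivAt.fun_sum fun y _ => HasDerivAt.fun_sum fun x _ => ?_
  have hlin : HasDerivAt (fun s : ℝ => M * C * s) (M * C) s := by
    simpa using (hasDerivAt_id s).const_mul (M * C)
  refine ((((hlin.exp.sub_const 1).div_const C).const_mul (f (dist x y))).const_add
    _).congr_deriv ?_
  field_simp

theorem lrKernel_nonneg (hf : ∀ r, 0 ≤ r → 0 ≤ f r) (hM : 0 ≤ M) (hC : 0 ≤ C) (hs : 0 ≤ s)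
    (x y : Γ) : 0 ≤ lrKernel f M C s x y :=
  add_nonneg (by positivity)
    (mul_nonneg (hf _ dist_nonneg) (exp_sub_one_div_nonneg hM hC hs))

theorem one_le_lrBound_zero (f : ℝ → ℝ) (M C : ℝ) {X Y : Finset Γ} (h : ¬ Disjoint X Y) :
    1 ≤ lrBound f M C X Y 0 := by
  obtain ⟨x, hxX, hxY⟩ := Finset.not_disjoint_iff.1 h
  have hzero (a b : Γ) : lrKernel f M C 0 a b = if a = b then 1 else 0 := by
    simp [lrKernel]
  have hnonneg (a b : Γ) : 0 ≤ lrKernel f M C 0 a b := by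
    rw [hzero]
    positivity
  calc (1 : ℝ) = lrKernel f M C 0 x x := by rw [hzero, if_pos rfl]
    _ ≤ ∑ a ∈ X, lrKernel f M C 0 a x := Finset.single_le_sum (fun a _ => hnonneg a x) hxX
    _ ≤ lrBound f M C X Y 0 :=
        Finset.single_le_sum (f := fun b => ∑ a ∈ X, lrKernel f M C 0 a b)
          (fun b _ => Finset.sum_nonneg fun a _ => hnonneg a b) hxY

theorem HasConvolutionBound.sum_lrKernel_mul_le (hconv : HasConvolutionBound Γ f C)
    (hf : ∀ r, 0 ≤ r → 0 ≤ f r) (hM : 0 ≤ M) (hC : 0 < C) (hs : 0 ≤ s) (x y : Γ)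
    (T : Finset Γ) :
    ∑ z ∈ T, lrKernel f M C s x z * (M * f (dist z y))
      ≤ M * f (dist x y) * Real.exp (M * C * s) := by
  have hg := exp_sub_one_div_nonneg hM hC.le hs
  have hdiag : ∑ z ∈ T, (if x = z then (1 : ℝ) else 0) * (M * f (dist z y))
      ≤ M * f (dist x y) := by
    simp only [ite_mul, one_mul, zero_mul, Finset.sum_ite_eq]
    split_ifs
    exacts [le_rfl, mul_nonneg hM (hf _ dist_nonneg)]
  calc ∑ z ∈ T, lrKernel f M C s x z * (M * f (dist z y))
      = ∑ z ∈ T, (if x = z then (1 : ℝ) else 0) * (M * f (dist z y))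
          + M * ((Real.exp (M * C * s) - 1) / C)
            * ∑ z ∈ T, f (dist x z) * f (dist z y) := by
        rw [Finset.mul_sum, ← Finset.sum_add_distrib]
        refine Finset.sum_congr rfl fun z _ => ?_
        rw [lrKernel]
        ring
    _ ≤ M * f (dist x y)
          + M * ((Real.exp (M * C * s) - 1) / C) * (C * f (dist x y)) := by
        gcongr
        exact hconv x y T
    _ = M * f (dist x y) * Real.exp (M * C * s) := by
        field_simp
        ring

end Kernel

namespace DissipativeFamily

section LiebRobinson

variable {Γ E : Type*} [MetricSpace Γ] [DecidableEq Γ] [NormedAddCommGroup E]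
  [NormedSpace ℂ E] {D : DissipativeFamily Γ E}

/-- The setting of the Lieb–Robinson bound: the terms of `D` decay like `F` with strength `M`,
and the convolution of `F` with itself is at most `C` times `F`. -/
structure DecaysAs (D : DissipativeFamily Γ E) (F : ℝ → ℝ) (M C : ℝ) : Prop where
  nonneg : ∀ r, 0 ≤ r → 0 ≤ F r
  strength_nonneg : 0 ≤ M
  const_pos : 0 < C
  convolution : HasConvolutionBound Γ F C
  sum_norm_term_le : ∀ y z : Γ,
    ∑ Z ∈ D.support with y ∈ Z ∧ z ∈ Z, ‖D.term Z‖ ≤ M * F (dist y z)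

variable {f : ℝ → ℝ} {M C s : ℝ}

theorem DecaysAs.lrKernel_nonneg (hD : D.DecaysAs f M C) (hs : 0 ≤ s) (x y : Γ) :
    0 ≤ lrKernel f M C s x y :=
  LRB.lrKernel_nonneg hD.nonneg hD.strength_nonneg hD.const_pos.le hs x y

theorem DecaysAs.lrBound_nonneg (hD : D.DecaysAs f M C) (X Y : Finset Γ) (hs : 0 ≤ s) :
    0 ≤ lrBound f M C X Y s :=
  Finset.sum_nonneg fun y _ => Finset.sum_nonneg fun x _ => hD.lrKernel_nonneg hs x y

theorem DecaysAs.sum_mul_lrBound_le (hD : D.DecaysAs f M C) (X Y : Finset Γ) (hs : 0 ≤ s) :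
    ∑ Z ∈ D.support with ¬ Disjoint Z Y, ‖D.term Z‖ * lrBound f M C X Z s
      ≤ lrBoundDeriv f M C X Y s := by
  refine (sum_not_disjoint_le _ Y fun Z => mul_nonneg (norm_nonneg _)
    (hD.lrBound_nonneg X Z hs)).trans (Finset.sum_le_sum fun y _ => ?_)
  set T := {Z ∈ D.support | y ∈ Z}
  calc ∑ Z ∈ T, ‖D.term Z‖ * lrBound f M C X Z s
      ≤ ∑ z ∈ T.biUnion id, (∑ x ∈ X, lrKernel f M C s x z) * (M * f (dist z y)) :=
        sum_mul_sum_le T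
          (fun z => Finset.sum_nonneg fun x _ => hD.lrKernel_nonneg hs x z)
          fun z => by
            rw [Finset.filter_filter, dist_comm]
            exact hD.sum_norm_term_le y z
    _ = ∑ x ∈ X, ∑ z ∈ T.biUnion id, lrKernel f M C s x z * (M * f (dist z y)) := by
        simp only [Finset.sum_mul]
        exact Finset.sum_comm
    _ ≤ ∑ x ∈ X, M * f (dist x y) * Real.exp (M * C * s) :=
        Finset.sum_le_sum fun x _ => hD.convolution.sum_lrKernel_mul_le hD.nonneg
          hD.strength_nonneg hD.const_pos hs x y _

theorem DecaysAs.dominates (hD : D.DecaysAs f M C) (X : Finset Γ) :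
    D.Dominates X (lrBound f M C X) (lrBound f M C X) (lrBoundDeriv f M C X) where
  hasDerivAt Y s := hasDerivAt_lrBound f M hD.const_pos.ne' X Y s
  nonneg_zero Y := hD.lrBound_nonneg X Y le_rfl
  one_le_zero _ hY := one_le_lrBound_zero f M C hY
  sum_le Y _ hs := hD.sum_mul_lrBound_le X Y hs

theorem DecaysAs.propagationBound [CompleteSpace E] (hD : D.DecaysAs f M C) {X : Finset Γ}
    {A : E} (hA : D.IsObservable X A) : D.PropagationBound X A (lrBound f M C X) :=
  (hD.dominates X).propagationBound (fun Y _ ht => hD.lrBound_nonneg X Y ht) hA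

end LiebRobinson

end DissipativeFamily

/-! ### Truncation of the interaction -/

section Damped

variable {F : ℝ → ℝ} {R C : ℝ}

/-- The decay function `F` with an additional exponential factor at scale `R`. -/
def damped (F : ℝ → ℝ) (R r : ℝ) : ℝ :=
  F r * Real.exp (-(r / R))

theorem damped_nonneg (hF : ∀ r, 0 ≤ r → 0 ≤ F r) (R : ℝ) {r : ℝ} (hr : 0 ≤ r) :
    0 ≤ damped F R r :=
  mul_nonneg (hF r hr) (Real.exp_pos _).le

theorem HasConvolutionBound.damped {Γ : Type*} [MetricSpace Γ]
    (hconv : HasConvolutionBound Γ F C) (hF : ∀ r, 0 ≤ r → 0 ≤ F r) (hR : 0 ≤ R) :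
    HasConvolutionBound Γ (damped F R) C := fun x y s => by
  have hterm (z : Γ) : LRB.damped F R (dist x z) * LRB.damped F R (dist z y)
      ≤ F (dist x z) * F (dist z y) * Real.exp (-(dist x y / R)) := by
    have hx := hF (dist x z) dist_nonneg
    have hy := hF (dist z y) dist_nonneg
    calc LRB.damped F R (dist x z) * LRB.damped F R (dist z y)
        = F (dist x z) * F (dist z y) * Real.exp (-((dist x z + dist z y) / R)) := by
          rw [LRB.damped, LRB.damped, add_div, neg_add, Real.exp_add]
          ring
      _ ≤ F (dist x z) * F (dist z y) * Real.exp (-(dist x y / R)) := by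
          gcongr
          exact dist_triangle x z y
  refine (Finset.sum_le_sum fun z _ => hterm z).trans ?_
  rw [← Finset.sum_mul, LRB.damped, ← mul_assoc]
  exact mul_le_mul_of_nonneg_right (hconv x y s) (Real.exp_pos _).le

-- `e ^ (-r / R) * (e ^ u - 1) ≤ 1 - e ^ (-u)` for `u ≤ r / R`, and `1 - e ^ (-u) ≤ min u 1`.
theorem damped_mul_exp_sub_one_le {u r : ℝ} (hF : 0 ≤ F r) (hu : 0 ≤ u) (hur : u ≤ r / R) :
    damped F R r * (Real.exp u - 1) ≤ F r * min u 1 := by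
  rw [damped, mul_assoc]
  refine mul_le_mul_of_nonneg_left ?_ hF
  calc Real.exp (-(r / R)) * (Real.exp u - 1) ≤ Real.exp (-u) * (Real.exp u - 1) := by
        gcongr
        exact sub_nonneg.2 (Real.one_le_exp hu)
    _ = 1 - Real.exp (-u) := by
        rw [mul_sub, ← Real.exp_add, neg_add_cancel, Real.exp_zero, mul_one]
    _ ≤ min u 1 :=
        le_min (by linarith [Real.add_one_le_exp (-u)]) (by linarith [Real.exp_pos (-u)])

theorem lrBound_damped_le {Γ : Type*} [MetricSpace Γ] [DecidableEq Γ]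
    (hF : ∀ r, 0 ≤ r → 0 ≤ F r) {M d s : ℝ} (hR : 0 < R) (hC : 0 ≤ C) (hd : 0 < d)
    (hu : 0 ≤ M * C * s) (hud : M * C * s ≤ d / R) {X Y : Finset Γ}
    (hXY : ∀ x ∈ X, ∀ y ∈ Y, d ≤ dist x y) :
    lrBound (damped F R) M C X Y s
      ≤ ∑ y ∈ Y, ∑ x ∈ X, F (dist x y) * (min (M * C * s) 1 / C) := by
  refine Finset.sum_le_sum fun y hy => Finset.sum_le_sum fun x hx => ?_
  have hxy : d ≤ dist x y := hXY x hx y hy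
  rw [lrKernel, if_neg (dist_pos.1 (hd.trans_le hxy)), zero_add, ← mul_div_assoc,
    ← mul_div_assoc]
  exact div_le_div_of_nonneg_right (damped_mul_exp_sub_one_le (hF _ dist_nonneg) hu
    (hud.trans (div_le_div_of_nonneg_right hxy hR.le))) hC

end Damped

section Leak

variable {Γ : Type*} [MetricSpace Γ] {F : ℝ → ℝ} {C d N B : ℝ}

/-- The weight with which the terms at `z` contribute to the propagation out of `X`. -/
def leakWeight (F : ℝ → ℝ) (C d : ℝ) (X : Finset Γ) (z : Γ) : ℝ :=
  ∑ x ∈ X, if dist x z < d then 1 else F (dist x z) / C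

theorem leakWeight_summand_nonneg (hF : ∀ r, 0 ≤ r → 0 ≤ F r) (hC : 0 ≤ C) (d : ℝ) (x z : Γ) :
    0 ≤ if dist x z < d then 1 else F (dist x z) / C := by
  split_ifs
  exacts [zero_le_one, div_nonneg (hF _ dist_nonneg) hC]

theorem leakWeight_nonneg (hF : ∀ r, 0 ≤ r → 0 ≤ F r) (hC : 0 ≤ C) (d : ℝ) (X : Finset Γ)
    (z : Γ) : 0 ≤ leakWeight F C d X z :=
  Finset.sum_nonneg fun x _ => leakWeight_summand_nonneg hF hC d x z

theorem one_le_leakWeight (hF : ∀ r, 0 ≤ r → 0 ≤ F r) (hC : 0 ≤ C) {X : Finset Γ} {x z : Γ}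
    (hx : x ∈ X) (hxz : dist x z < d) : 1 ≤ leakWeight F C d X z :=
  (if_pos hxz).ge.trans (Finset.single_le_sum
    (f := fun x => if dist x z < d then (1 : ℝ) else F (dist x z) / C)
    (fun x _ => leakWeight_summand_nonneg hF hC d x z) hx)

theorem sum_leakWeight_le (hC : 0 ≤ C) (hN : HasBallBound Γ d N) (hB : HasTailBound Γ F d B)
    (X S : Finset Γ) : ∑ z ∈ S, leakWeight F C d X z ≤ X.card * (N + B / C) := by
  unfold leakWeight
  rw [Finset.sum_comm, ← nsmul_eq_mul]
  refine Finset.sum_le_card_nsmul _ _ _ fun x _ => ?_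
  rw [Finset.sum_ite, ← Finset.sum_div, Finset.sum_const, nsmul_eq_mul, mul_one]
  gcongr
  · exact hN x _ fun y hy => (Finset.mem_filter.1 hy).2
  · exact hB x _ fun y hy => not_lt.1 (Finset.mem_filter.1 hy).2

end Leak

namespace DissipativeFamily

section Truncation

variable {Γ E : Type*} [MetricSpace Γ] [NormedAddCommGroup E] [NormedSpace ℂ E]

/-- The terms whose labels have diameter at most `R`. -/
def short (D : DissipativeFamily Γ E) (R : ℝ) : DissipativeFamily Γ E :=
  D.restrict fun Z => ∀ x ∈ Z, ∀ y ∈ Z, dist x y ≤ R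

/-- The terms whose labels have diameter greater than `R`. -/
def long (D : DissipativeFamily Γ E) (R : ℝ) : DissipativeFamily Γ E :=
  D.restrict fun Z => ¬ ∀ x ∈ Z, ∀ y ∈ Z, dist x y ≤ R

variable {D : DissipativeFamily Γ E} {F : ℝ → ℝ} {M C R B : ℝ}

theorem exists_half_le_dist_of_mem_long {Z : Finset Γ} (hZ : Z ∈ (D.long R).support) (z : Γ) :
    ∃ y ∈ Z, R / 2 ≤ dist z y := by
  by_contra! hsmall
  refine (Finset.mem_filter.1 hZ).2 fun x hx y hy => ?_
  linarith [hsmall x hx, hsmall y hy, dist_triangle_left x y z]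

variable [DecidableEq Γ]

theorem DecaysAs.sum_norm_term_short_le (hD : D.DecaysAs F M C) (hR : 0 < R) (y z : Γ) :
    ∑ Z ∈ (D.short R).support with y ∈ Z ∧ z ∈ Z, ‖D.term Z‖
      ≤ Real.exp 1 * M * damped F R (dist y z) := by
  have hM := hD.strength_nonneg
  have hFyz := hD.nonneg (dist y z) dist_nonneg
  by_cases hyz : dist y z ≤ R
  · have hexp : 1 ≤ Real.exp 1 * Real.exp (-(dist y z / R)) := by
      rw [← Real.exp_add]
      exact Real.one_le_exp (by linarith [(div_le_one hR).2 hyz])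
    calc ∑ Z ∈ (D.short R).support with y ∈ Z ∧ z ∈ Z, ‖D.term Z‖
        ≤ ∑ Z ∈ D.support with y ∈ Z ∧ z ∈ Z, ‖D.term Z‖ :=
          Finset.sum_le_sum_of_subset_of_nonneg
            (Finset.filter_subset_filter _ (Finset.filter_subset _ _)) fun _ _ _ => norm_nonneg _
      _ ≤ M * F (dist y z) := hD.sum_norm_term_le y z
      _ ≤ M * F (dist y z) * (Real.exp 1 * Real.exp (-(dist y z / R))) :=
          le_mul_of_one_le_right (mul_nonneg hM hFyz) hexp
      _ = Real.exp 1 * M * damped F R (dist y z) := by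
          rw [damped]
          ring
  · rw [Finset.filter_false_of_mem, Finset.sum_empty]
    · have := damped_nonneg hD.nonneg R (dist_nonneg (x := y) (y := z))
      positivity
    · exact fun Z hZ h => hyz ((Finset.mem_filter.1 hZ).2 y h.1 z h.2)

theorem DecaysAs.short (hD : D.DecaysAs F M C) (hR : 0 < R) :
    (D.short R).DecaysAs (damped F R) (Real.exp 1 * M) C where
  nonneg _ hr := damped_nonneg hD.nonneg R hr
  strength_nonneg := mul_nonneg (Real.exp_pos 1).le hD.strength_nonneg
  const_pos := hD.const_pos
  convolution := hD.convolution.damped hD.nonneg hR.le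
  sum_norm_term_le := hD.sum_norm_term_short_le hR

theorem DecaysAs.sum_long_le (hD : D.DecaysAs F M C)
    (hB : HasTailBound Γ F (R / 2) B) (z : Γ) :
    ∑ Z ∈ (D.long R).support with z ∈ Z, ‖D.term Z‖ ≤ M * B := by
  set T := {Z ∈ (D.long R).support | z ∈ Z}
  set V := {y ∈ T.biUnion id | R / 2 ≤ dist z y}
  have hT : {Z ∈ T | ¬ Disjoint Z V} = T := Finset.filter_true_of_mem fun Z hZ => by
    obtain ⟨y, hy, hzy⟩ := exists_half_le_dist_of_mem_long (Finset.mem_filter.1 hZ).1 z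
    exact Finset.not_disjoint_iff.2
      ⟨y, hy, Finset.mem_filter.2 ⟨Finset.mem_biUnion.2 ⟨Z, hZ, hy⟩, hzy⟩⟩
  have hpair (y : Γ) : ∑ Z ∈ T with y ∈ Z, ‖D.term Z‖ ≤ M * F (dist z y) := by
    refine (Finset.sum_le_sum_of_subset_of_nonneg ?_ fun _ _ _ => norm_nonneg _).trans
      (hD.sum_norm_term_le z y)
    rw [Finset.filter_filter]
    exact Finset.filter_subset_filter _ (Finset.filter_subset _ _)
  calc ∑ Z ∈ T, ‖D.term Z‖ = ∑ Z ∈ T with ¬ Disjoint Z V, ‖D.term Z‖ := by rw [hT]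
    _ ≤ ∑ y ∈ V, ∑ Z ∈ T with y ∈ Z, ‖D.term Z‖ :=
        sum_not_disjoint_le T V fun _ => norm_nonneg _
    _ ≤ ∑ y ∈ V, M * F (dist z y) := Finset.sum_le_sum fun y _ => hpair y
    _ ≤ M * B := by
        rw [← Finset.mul_sum]
        exact mul_le_mul_of_nonneg_left (hB z V fun y hy => (Finset.mem_filter.1 hy).2)
          hD.strength_nonneg

variable [CompleteSpace E] {X Y : Finset Γ} {A : E} {k : E →L[ℂ] E} {d s t N B₁ B₂ : ℝ}

theorem DecaysAs.norm_apply_flow_short_le (hD : D.DecaysAs F M C) (hA : D.IsObservable X A)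
    (hk : D.ActsOn Y k) (hkA : Disjoint X Y → k A = 0) (hR : 0 < R) (hd : 0 < d)
    (hXY : ∀ x ∈ X, ∀ y ∈ Y, d ≤ dist x y) (hs : 0 ≤ s)
    (hsR : Real.exp 1 * M * C * s ≤ d / R) :
    ‖k (flow (D.short R).generator s A)‖
      ≤ ‖k‖ * (‖A‖ * ∑ y ∈ Y, ∑ x ∈ X,
          F (dist x y) * (min (Real.exp 1 * M * C * s) 1 / C)) := by
  have hM := hD.strength_nonneg
  have hC := hD.const_pos
  have hlr : (D.short R).PropagationBound X A (lrBound (damped F R) (Real.exp 1 * M) C X) :=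
    (hD.short hR).propagationBound (hA.restrict _)
  refine (hlr Y k (hk.restrict _) hkA s hs).trans ?_
  gcongr
  exact lrBound_damped_le hD.nonneg hR hC.le hd (by positivity) hsR hXY

theorem DecaysAs.norm_apply_flow_short_le_of_hasTailBound (hD : D.DecaysAs F M C)
    (hA : D.IsObservable X A) (hk : D.ActsOn Y k) (hkA : k A = 0) (hR : 0 < R) (hd : 0 < d)
    (hXY : ∀ x ∈ X, ∀ y ∈ Y, d ≤ dist x y) (hB₁ : HasTailBound Γ F d B₁) (hs : 0 ≤ s)
    (hsR : Real.exp 1 * M * C * s ≤ d / R) :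
    ‖k (flow (D.short R).generator s A)‖
      ≤ ‖k‖ * (‖A‖ * (X.card * B₁ * (Real.exp 1 * M * s))) := by
  have hM := hD.strength_nonneg
  have hmin : min (Real.exp 1 * M * C * s) 1 / C ≤ Real.exp 1 * M * s :=
    (div_le_iff₀ hD.const_pos).2 ((min_le_left _ _).trans_eq (by ring))
  refine (hD.norm_apply_flow_short_le hA hk (fun _ => hkA) hR hd hXY hs hsR).trans ?_
  gcongr ‖k‖ * (‖A‖ * ?_)
  calc ∑ y ∈ Y, ∑ x ∈ X, F (dist x y) * (min (Real.exp 1 * M * C * s) 1 / C)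
      ≤ ∑ y ∈ Y, ∑ x ∈ X, F (dist x y) * (Real.exp 1 * M * s) :=
        Finset.sum_le_sum fun y _ => Finset.sum_le_sum fun x _ =>
          mul_le_mul_of_nonneg_left hmin (hD.nonneg _ dist_nonneg)
    _ ≤ X.card * B₁ * (Real.exp 1 * M * s) := by
        simp only [← Finset.sum_mul]
        exact mul_le_mul_of_nonneg_right (hB₁.sum_sum_le hXY) (by positivity)

theorem DecaysAs.norm_term_flow_short_le (hD : D.DecaysAs F M C) (hA : D.IsObservable X A)
    (hR : 0 < R) (hd : 0 < d) (hs : 0 ≤ s) (hsR : Real.exp 1 * M * C * s ≤ d / R)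
    {Z : Finset Γ} (hZ : Z ∈ D.support) :
    ‖D.term Z (flow (D.short R).generator s A)‖
      ≤ ‖D.term Z‖ * (‖A‖ * ∑ z ∈ Z, leakWeight F C d X z) := by
  have hC := hD.const_pos
  by_cases hnear : ∃ z ∈ Z, ∃ x ∈ X, dist x z < d
  · obtain ⟨z, hz, x, hx, hxz⟩ := hnear
    have hone : 1 ≤ ∑ z ∈ Z, leakWeight F C d X z :=
      (one_le_leakWeight hD.nonneg hD.const_pos.le hx hxz).trans
        (Finset.single_le_sum (fun z _ => leakWeight_nonneg hD.nonneg hD.const_pos.le d X z) hz)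
    exact (D.term Z).le_opNorm_of_le (((D.short R).norm_flow_apply_le hs A).trans
      (le_mul_of_one_le_right (norm_nonneg A) hone))
  · push Not at hnear
    refine (hD.norm_apply_flow_short_le hA (actsOn_term hZ) (hA Z hZ) hR hd
      (fun x hx z hz => hnear z hz x hx) hs hsR).trans ?_
    gcongr with z hz
    refine Finset.sum_le_sum fun x hx => ?_
    rw [if_neg (not_lt.2 (hnear z hz x hx)), ← mul_div_assoc]
    exact div_le_div_of_nonneg_right
      (mul_le_of_le_one_right (hD.nonneg _ dist_nonneg) (min_le_right _ _)) hC.le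

theorem DecaysAs.norm_generator_long_le (hD : D.DecaysAs F M C) (hA : D.IsObservable X A)
    (hR : 0 < R) (hd : 0 < d) (hN : HasBallBound Γ d N) (hB₁ : HasTailBound Γ F d B₁)
    (hB₂ : HasTailBound Γ F (R / 2) B₂) (hB₂0 : 0 ≤ B₂) (hs : 0 ≤ s)
    (hsR : Real.exp 1 * M * C * s ≤ d / R) :
    ‖(D.long R).generator (flow (D.short R).generator s A)‖
      ≤ ‖A‖ * (X.card * (N + B₁ / C) * (M * B₂)) := by
  have hM := hD.strength_nonneg
  set T := (D.long R).support
  have hsub (Z : Finset Γ) (hZ : Z ∈ T) : Z ∈ D.support := (Finset.mem_filter.1 hZ).1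
  calc ‖(D.long R).generator (flow (D.short R).generator s A)‖
      ≤ ∑ Z ∈ T, ‖D.term Z (flow (D.short R).generator s A)‖ := norm_generator_apply_le _ _
    _ ≤ ∑ Z ∈ T, ‖D.term Z‖ * (‖A‖ * ∑ z ∈ Z, leakWeight F C d X z) :=
        Finset.sum_le_sum fun Z hZ =>
          hD.norm_term_flow_short_le hA hR hd hs hsR (hsub Z hZ)
    _ = ‖A‖ * ∑ Z ∈ T, ‖D.term Z‖ * ∑ z ∈ Z, leakWeight F C d X z := by
        simp only [mul_left_comm _ ‖A‖, ← Finset.mul_sum]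
    _ ≤ ‖A‖ * ∑ z ∈ T.biUnion id, leakWeight F C d X z * (M * B₂) := by
        gcongr
        exact sum_mul_sum_le T (fun z => leakWeight_nonneg hD.nonneg hD.const_pos.le d X z)
          fun z => hD.sum_long_le hB₂ z
    _ ≤ ‖A‖ * (X.card * (N + B₁ / C) * (M * B₂)) := by
        rw [← Finset.sum_mul]
        exact mul_le_mul_of_nonneg_left (mul_le_mul_of_nonneg_right
          (sum_leakWeight_le hD.const_pos.le hN hB₁ X _) (mul_nonneg hM hB₂0)) (norm_nonneg A)

-- Duhamel's formula compares the full dynamics with the one generated by the short terms,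
-- whose propagation is controlled by a Lieb–Robinson bound with exponential decay.
theorem DecaysAs.norm_apply_flow_le (hD : D.DecaysAs F M C) (hA : D.IsObservable X A)
    (hk : D.ActsOn Y k) (hkA : k A = 0) (hR : 0 < R) (hd : 0 < d)
    (hXY : ∀ x ∈ X, ∀ y ∈ Y, d ≤ dist x y) (hN : HasBallBound Γ d N)
    (hB₁ : HasTailBound Γ F d B₁) (hB₂ : HasTailBound Γ F (R / 2) B₂) (hB₂0 : 0 ≤ B₂)
    (ht : 0 ≤ t) (htR : Real.exp 1 * M * C * t ≤ d / R) :
    ‖k (flow D.generator t A)‖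
      ≤ ‖k‖ * (‖A‖ * (X.card * (M * t * (Real.exp 1 * B₁ + B₂ * (N + B₁ / C))))) := by
  have hM := hD.strength_nonneg
  have hC := hD.const_pos
  set P := (D.short R).generator
  set Q := (D.long R).generator
  have hPQ : P + Q = D.generator := D.generator_restrict_add_not _
  have hshort := hD.norm_apply_flow_short_le_of_hasTailBound hA hk hkA hR hd hXY hB₁ ht htR
  have hlong : ‖flow (P + Q) t A - flow P t A‖
      ≤ ‖A‖ * (X.card * (N + B₁ / C) * (M * B₂)) * t := by
    refine norm_flow_add_sub_flow_le (fun s hs => ?_) A ht fun s hs hst => ?_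
    · rw [hPQ]
      exact D.norm_flow_sum_le_one _ subset_rfl s hs
    · exact hD.norm_generator_long_le hA hR hd hN hB₁ hB₂ hB₂0 hs
        (le_trans (by gcongr) htR)
  calc ‖k (flow D.generator t A)‖
      = ‖k (flow P t A) + k (flow (P + Q) t A - flow P t A)‖ := by
        rw [← map_add, add_sub_cancel, hPQ]
    _ ≤ ‖k‖ * (‖A‖ * (X.card * B₁ * (Real.exp 1 * M * t)))
          + ‖k‖ * (‖A‖ * (X.card * (N + B₁ / C) * (M * B₂)) * t) :=
        norm_add_le_of_le hshort (k.le_opNorm_of_le hlong)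
    _ = ‖k‖ * (‖A‖ * (X.card * (M * t * (Real.exp 1 * B₁ + B₂ * (N + B₁ / C))))) := by
        ring

end Truncation

end DissipativeFamily

/-! ### The finite-volume dynamics -/

section SetDist

variable {Γ : Type*} [MetricSpace Γ] {X Y : Finset Γ}

theorem setDist_le {x y : Γ} (hx : x ∈ X) (hy : y ∈ Y) : setDist X Y ≤ dist x y :=
  csInf_le ⟨0, by rintro r ⟨_, _, _, _, rfl⟩; exact dist_nonneg⟩ ⟨x, hx, y, hy, rfl⟩

theorem nonempty_of_setDist_pos (h : 0 < setDist X Y) : X.Nonempty := by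
  rw [Finset.nonempty_iff_ne_empty]
  rintro rfl
  simp [setDist] at h

theorem disjoint_of_setDist_pos (h : 0 < setDist X Y) : Disjoint X Y :=
  Finset.disjoint_left.2 fun z hX hY => h.not_ge ((setDist_le hX hY).trans_eq (dist_self z))

end SetDist

section Dynamics

variable {Γ : Type*} [DecidableEq Γ] {ι : Γ → Type*} [∀ x, Fintype (ι x)]

namespace Interaction

/-- The term `L_Z` as an operator on the observables on `Λ`; the value is `0` unless `Z ⊆ Λ`. -/
def localTerm (L : Interaction ι) (Λ Z : Finset Γ) : LocalAlg ι Λ →L[ℂ] LocalAlg ι Λ :=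
  if h : Z ⊆ Λ then LinearMap.toContinuousLinearMap (extend h (L.term Z)) else 0

theorem localTerm_eq (L : Interaction ι) {Λ Z : Finset Γ} (h : Z ⊆ Λ) :
    L.localTerm Λ Z = LinearMap.toContinuousLinearMap (extend h (L.term Z)) :=
  dif_pos h

theorem commute_localTerm (L : Interaction ι) {Y Z Λ : Finset Γ} (hZ : Z ⊆ Λ) (hY : Y ⊆ Λ)
    (hd : Disjoint Z Y) (Ψ : LocalAlg ι Y →ₗ[ℂ] LocalAlg ι Y) :
    Commute (L.localTerm Λ Z) (LinearMap.toContinuousLinearMap (extend hY Ψ)) := by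
  rw [L.localTerm_eq hZ]
  exact ContinuousLinearMap.ext fun M => extend_comm hZ hY hd (L.term Z) Ψ M

variable [∀ x, DecidableEq (ι x)]

theorem isDissipative_localTerm (L : Interaction ι) {Z Λ : Finset Γ} (hZ : Z ⊆ Λ) :
    IsDissipative (L.localTerm Λ Z) := by
  rw [L.localTerm_eq hZ]
  exact ((L.lindblad Z).extend hZ).isDissipative

/-- The terms of the generator of the volume `Λ`. -/
def localFamily (L : Interaction ι) (Λ : Finset Γ) : DissipativeFamily Γ (LocalAlg ι Λ) where
  support := Λ.powerset
  term := L.localTerm Λ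
  norm_flow_sum_le_one _ hS _ ht := (IsDissipative.sum fun _ hZ =>
    L.isDissipative_localTerm (Finset.mem_powerset.1 (hS hZ))).norm_flow_le_one ht
  commute Z hZ Z' hZ' hd := by
    rw [L.localTerm_eq (Finset.mem_powerset.1 hZ')]
    exact L.commute_localTerm (Finset.mem_powerset.1 hZ) _ hd _

theorem term_localFamily (L : Interaction ι) {Z Λ : Finset Γ} (hZ : Z ⊆ Λ) :
    (L.localFamily Λ).term Z = LinearMap.toContinuousLinearMap (extend hZ (L.term Z)) :=
  L.localTerm_eq hZ

theorem toContinuousLinearMap_generator (L : Interaction ι) (Λ : Finset Γ) :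
    LinearMap.toContinuousLinearMap (L.generator Λ) = (L.localFamily Λ).generator := by
  rw [Interaction.generator, map_sum, DissipativeFamily.generator,
    ← Finset.sum_attach (L.localFamily Λ).support]
  exact Finset.sum_congr rfl fun Z _ => (L.term_localFamily (Finset.mem_powerset.1 Z.2)).symm

theorem dynamics_apply (L : Interaction ι) (Λ : Finset Γ) (t : ℝ) (B : LocalAlg ι Λ) :
    L.dynamics Λ t B = flow (L.localFamily Λ).generator t B := by
  rw [← L.toContinuousLinearMap_generator]
  rfl

theorem actsOn_extend (L : Interaction ι) {Y Λ : Finset Γ} (hY : Y ⊆ Λ)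
    (K : LocalAlg ι Y →ₗ[ℂ] LocalAlg ι Y) :
    (L.localFamily Λ).ActsOn Y (LinearMap.toContinuousLinearMap (extend hY K)) :=
  fun _ hZ hd => L.commute_localTerm (Finset.mem_powerset.1 hZ) hY hd K

theorem isObservable_embed (L : Interaction ι) {X Λ : Finset Γ} (hX : X ⊆ Λ)
    (A : LocalAlg ι X) : (L.localFamily Λ).IsObservable X (embed hX A) := fun Z hZ hd => by
  rw [L.term_localFamily (Finset.mem_powerset.1 hZ)]
  exact extend_embed_eq_zero hX _ hd (L.lindblad Z).map_one A

end Interaction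

variable [∀ x, DecidableEq (ι x)]

theorem norm_toContinuousLinearMap_extend_le {Z Λ : Finset Γ} (h : Z ⊆ Λ)
    {Φ : LocalAlg ι Z →ₗ[ℂ] LocalAlg ι Z} (hΦ : cbNorm Φ < ∞) :
    ‖LinearMap.toContinuousLinearMap (extend h Φ)‖ ≤ (cbNorm Φ).toReal :=
  ContinuousLinearMap.opNorm_le_bound _ ENNReal.toReal_nonneg fun M => norm_extend_le h hΦ M

end Dynamics

section Propagation

variable {Γ : Type*} [MetricSpace Γ] [DecidableEq Γ] {ι : Γ → Type*} [∀ x, Fintype (ι x)]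
  [∀ x, DecidableEq (ι x)] {F : ℝ → ℝ}

theorem Interaction.decaysAs_localFamily [Nonempty Γ] (L : Interaction ι)
    (hF : ∀ r, 0 ≤ r → 0 < F r) (hL : L.fNorm F < ∞) (hC : convConst Γ F < ∞) (Λ : Finset Γ) :
    (L.localFamily Λ).DecaysAs F (L.fNorm F).toReal (convConst Γ F).toReal where
  nonneg r hr := (hF r hr).le
  strength_nonneg := ENNReal.toReal_nonneg
  const_pos := (hasConvolutionBound_convConst hF hC).pos hF (Classical.arbitrary Γ)
  convolution := hasConvolutionBound_convConst hF hC
  sum_norm_term_le y z := by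
    refine (Finset.sum_le_sum fun Z hZ => ?_).trans
      (L.sum_cbNorm_toReal_le hF hL y z _ fun Z hZ => (Finset.mem_filter.1 hZ).2)
    obtain ⟨hZΛ, hyZ, -⟩ := Finset.mem_filter.1 hZ
    rw [L.term_localFamily (Finset.mem_powerset.1 hZΛ)]
    exact norm_toContinuousLinearMap_extend_le _ (L.cbNorm_term_lt_top hF hL ⟨y, hyZ⟩)

theorem Interaction.norm_extend_dynamics_embed_le (L : Interaction ι)
    (hF : ∀ r, 0 ≤ r → 0 < F r) (hL : L.fNorm F < ∞) (hC : convConst Γ F < ∞)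
    {X Y Λ : Finset Γ} (hX : X ⊆ Λ) (hY : Y ⊆ Λ) (A : LocalAlg ι X)
    {K : LocalAlg ι Y →ₗ[ℂ] LocalAlg ι Y} (hK : IsCB0 K) {R N B₁ B₂ t : ℝ} (hR : 0 < R)
    (hd : 0 < setDist X Y) (hN : HasBallBound Γ (setDist X Y) N)
    (hB₁ : HasTailBound Γ F (setDist X Y) B₁) (hB₂ : HasTailBound Γ F (R / 2) B₂) (ht : 0 ≤ t)
    (htR : Real.exp 1 * (L.fNorm F).toReal * (convConst Γ F).toReal * t ≤ setDist X Y / R) :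
    ‖extend hY K (L.dynamics Λ t (embed hX A))‖
      ≤ (cbNorm K).toReal * (‖A‖ * (X.card * ((L.fNorm F).toReal * t *
          (Real.exp 1 * B₁ + B₂ * (N + B₁ / (convConst Γ F).toReal))))) := by
  obtain ⟨x, -⟩ := nonempty_of_setDist_pos hd
  have : Nonempty Γ := ⟨x⟩
  have hN0 := hN.nonneg x
  have hB₁0 := hB₁.nonneg x
  have hB₂0 := hB₂.nonneg x
  have hbound := (L.decaysAs_localFamily hF hL hC Λ).norm_apply_flow_le
    (L.isObservable_embed hX A) (L.actsOn_extend hY K)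
    (extend_embed_eq_zero hX hY (disjoint_of_setDist_pos hd) hK.2 A) hR hd
    (fun _ hx _ hy => setDist_le hx hy) hN hB₁ hB₂ hB₂0 ht htR
  rw [← L.dynamics_apply] at hbound
  refine hbound.trans ?_
  gcongr
  exacts [norm_toContinuousLinearMap_extend_le hY hK.1, norm_embed_le hX A]

end Propagation

section PowerLaw

theorem truncation_error_le {κ ν β θ d S C : ℝ} (hκ : 0 ≤ κ) (hν : 0 ≤ ν) (hβ : 0 ≤ β)
    (hθ : 0 ≤ θ) (hθ' : θ ≤ 1) (hd : 0 ≤ d) (hS : 0 ≤ S) (hC : 0 < C) :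
    powerLaw β (d ^ θ / 2) * (κ * (1 + d) ^ ν + κ * S * powerLaw β d / C)
      ≤ κ * 2 ^ (2 * β) * 2 ^ θ * ((S + C) / C) * powerLaw (θ * β - ν) d := by
  have hdθ : 0 ≤ d ^ θ := Real.rpow_nonneg hd θ
  have hp := (powerLaw_pos (θ * β - ν) hd).le
  have htail : powerLaw β (d ^ θ / 2) ≤ 2 ^ β * powerLaw (θ * β) d :=
    (powerLaw_le_two_rpow_mul hβ hdθ le_rfl).trans
      (mul_le_mul_of_nonneg_left (powerLaw_rpow_le hβ hθ hθ' hd) (by positivity))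
  have hweight : κ * (1 + d) ^ ν + κ * S * powerLaw β d / C
      ≤ κ * ((S + C) / C) * (1 + d) ^ ν :=
    calc κ * (1 + d) ^ ν + κ * S * powerLaw β d / C
        ≤ κ * (1 + d) ^ ν + κ * S * (1 + d) ^ ν / C := by
          gcongr
          exact powerLaw_le_rpow hβ hν hd
      _ = κ * ((S + C) / C) * (1 + d) ^ ν := by
          field_simp
          ring
  have hconst : (2 : ℝ) ^ β ≤ 2 ^ (2 * β) * 2 ^ θ := by
    rw [← Real.rpow_add two_pos]
    exact Real.rpow_le_rpow_of_exponent_le one_le_two (by linarith)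
  calc powerLaw β (d ^ θ / 2) * (κ * (1 + d) ^ ν + κ * S * powerLaw β d / C)
      ≤ 2 ^ β * powerLaw (θ * β) d * (κ * ((S + C) / C) * (1 + d) ^ ν) :=
        mul_le_mul htail hweight
          (by have := (powerLaw_pos β hd).le; positivity)
          (by have := (powerLaw_pos (θ * β) hd).le; positivity)
    _ = κ * 2 ^ β * ((S + C) / C) * powerLaw (θ * β - ν) d := by
        rw [← powerLaw_mul_rpow _ _ hd]
        ring
    _ ≤ κ * (2 ^ (2 * β) * 2 ^ θ) * ((S + C) / C) * powerLaw (θ * β - ν) d := by gcongr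
    _ = κ * 2 ^ (2 * β) * 2 ^ θ * ((S + C) / C) * powerLaw (θ * β - ν) d := by ring

theorem truncation_bound_le {κ ν β θ d S C : ℝ} (hκ : 0 ≤ κ) (hν : 0 ≤ ν) (hβ : 0 ≤ β)
    (hθ : 0 ≤ θ) (hθ' : θ ≤ 1) (hd : 0 ≤ d) (hS : 0 ≤ S) (hC : 0 < C) :
    Real.exp 1 * (κ * S * powerLaw β d) + κ * S * powerLaw β (d ^ θ / 2)
        * (κ * (1 + d) ^ ν + κ * S * powerLaw β d / C)
      ≤ κ * S * (Real.exp 1 + κ * 2 ^ (2 * β) * 2 ^ θ * ((S + C) / C))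
        * powerLaw (θ * β - ν) d := by
  have hshort : powerLaw β d ≤ powerLaw (θ * β - ν) d :=
    powerLaw_le_powerLaw (by nlinarith) hd
  calc Real.exp 1 * (κ * S * powerLaw β d) + κ * S * powerLaw β (d ^ θ / 2)
        * (κ * (1 + d) ^ ν + κ * S * powerLaw β d / C)
      = κ * S * (Real.exp 1 * powerLaw β d + powerLaw β (d ^ θ / 2)
          * (κ * (1 + d) ^ ν + κ * S * powerLaw β d / C)) := by ring
    _ ≤ κ * S * (Real.exp 1 * powerLaw (θ * β - ν) d
          + κ * 2 ^ (2 * β) * 2 ^ θ * ((S + C) / C) * powerLaw (θ * β - ν) d) := by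
        gcongr ?_ * (Real.exp 1 * ?_ + ?_)
        exact truncation_error_le hκ hν hβ hθ hθ' hd hS hC
    _ = κ * S * (Real.exp 1 + κ * 2 ^ (2 * β) * 2 ^ θ * ((S + C) / C))
          * powerLaw (θ * β - ν) d := by ring

variable {Γ : Type*} [MetricSpace Γ] [DecidableEq Γ] {ι : Γ → Type*} [∀ x, Fintype (ι x)]
  [∀ x, DecidableEq (ι x)]

theorem Interaction.norm_extend_dynamics_embed_le_powerLaw {κ ν β γ δ S M C : ℝ}
    (hΓ : IsRegular Γ κ ν) (hν : 0 ≤ ν) (hβ : 1 < β) (hγ : 0 ≤ γ) (hδ : 0 ≤ δ) (hδ' : δ ≤ 1)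
    (hS : S = ∑' n : ℕ, powerLaw β n) (L : Interaction ι)
    (hL : L.fNorm (powerLaw (γ + (ν + β))) < ∞)
    (hM : M = (L.fNorm (powerLaw (γ + (ν + β)))).toReal)
    (hC : C = (convConst Γ (powerLaw (γ + (ν + β)))).toReal) {X Y Λ : Finset Γ} (hX : X ⊆ Λ)
    (hY : Y ⊆ Λ) (A : LocalAlg ι X) {K : LocalAlg ι Y →ₗ[ℂ] LocalAlg ι Y} (hK : IsCB0 K)
    (hd : 0 < setDist X Y) {t : ℝ} (ht : 0 ≤ t)
    (hvt : Real.exp 1 * (M * C) * t ≤ setDist X Y ^ δ) :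
    ‖extend hY K (L.dynamics Λ t (embed hX A))‖
      ≤ κ * S * M * (Real.exp 1 + κ * 2 ^ (2 * γ) * 2 ^ (1 - δ) * ((S + C) / C))
        * (cbNorm K).toReal * ‖A‖ * X.card
        * (t / (1 + setDist X Y) ^ ((1 - δ) * γ - ν)) := by
  set d := setDist X Y
  set F := powerLaw (γ + (ν + β))
  obtain ⟨x, -⟩ := nonempty_of_setDist_pos hd
  have hκ := hΓ.nonneg x
  have hνβ : 0 ≤ ν + β := by linarith
  have hF (r : ℝ) (hr : 0 ≤ r) : 0 < F r := powerLaw_pos _ hr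
  have hconv : convConst Γ F < ∞ := hΓ.convConst_powerLaw_lt_top hνβ hβ hγ
  have hC0 : 0 < C := hC ▸ (hasConvolutionBound_convConst hF hconv).pos hF x
  have hM0 : 0 ≤ M := hM ▸ ENNReal.toReal_nonneg
  have hS0 : 0 ≤ S := hS ▸ tsum_nonneg fun n => (powerLaw_pos β n.cast_nonneg).le
  have hscale : d / d ^ (1 - δ) = d ^ δ := by
    rw [div_eq_iff (by positivity), ← Real.rpow_add hd, add_sub_cancel, Real.rpow_one]
  have hbound := L.norm_extend_dynamics_embed_le hF hL hconv hX hY A hK (R := d ^ (1 - δ))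
    (by positivity) hd (hΓ.hasBallBound hν hd.le) (hΓ.hasTailBound_powerLaw hνβ hβ hγ hd.le)
    (hΓ.hasTailBound_powerLaw hνβ hβ hγ (by positivity)) ht
    (by rwa [hscale, ← hM, ← hC, mul_assoc (Real.exp 1)])
  rw [← hM, ← hC, ← hS] at hbound
  refine hbound.trans ?_
  calc _ ≤ (cbNorm K).toReal * (‖A‖ * (X.card * (M * t * (κ * S
          * (Real.exp 1 + κ * 2 ^ (2 * γ) * 2 ^ (1 - δ) * ((S + C) / C))
          * powerLaw ((1 - δ) * γ - ν) d)))) := by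
        gcongr
        exact truncation_bound_le hκ hν hγ (by linarith) (by linarith) hd.le hS0 hC0
    _ = _ := by
        rw [powerLaw]
        ring

end PowerLaw

end LRB

end

theorem theorem2p6_general
    {Γ : Type*} [MetricSpace Γ] [DecidableEq Γ]
    {ι : Γ → Type*} [∀ x, Fintype (ι x)] [∀ x, DecidableEq (ι x)]
    (κ ν : ℝ) (hν : 0 ≤ ν) (hΓ : LRB.IsRegular Γ κ ν)
    (α : ℝ) (L : LRB.Interaction ι) (hL : L.fNorm (LRB.powerLaw α) < ∞)
    (ε : ℝ) (hε : 0 < ε) (αε : ℝ) (hαε : αε = α - ν - 1 - ε) (hαε0 : 0 ≤ αε)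
    (δ : ℝ) (hδ : 0 ≤ δ) (hδ' : δ ≤ 1) (CF normL v Cε : ℝ)
    (hCF : CF = (LRB.convConst Γ (LRB.powerLaw α)).toReal)
    (hnormL : normL = (L.fNorm (LRB.powerLaw α)).toReal)
    (hv : v = normL * CF)
    (hCε : Cε = ∑' n : ℕ, 1 / (1 + (n : ℝ)) ^ (1 + ε))
    (X Y Λ : Finset Γ) (hX : X ⊆ Λ) (hY : Y ⊆ Λ)
    (A : LRB.LocalAlg ι X) (K : LRB.LocalAlg ι Y →ₗ[ℂ] LRB.LocalAlg ι Y) (hK : LRB.IsCB0 K)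
    (d : ℝ) (hd : d = LRB.setDist X Y) (hd0 : 0 < d) :
    (∃ C : ℝ, 0 < C ∧ ∀ t : ℝ, 0 ≤ t → Real.exp 1 * v * t ≤ d ^ δ →
      ‖LRB.extend hY K (L.dynamics Λ t (LRB.embed hX A))‖
        ≤ C * (LRB.cbNorm K).toReal * ‖A‖ * (X.card : ℝ) *
          (t / (1 + d) ^ ((1 - δ) * αε - ν))) ∧
    (∀ t : ℝ, 0 ≤ t → Real.exp 1 * v * t ≤ d ^ δ →
      ‖LRB.extend hY K (L.dynamics Λ t (LRB.embed hX A))‖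
        ≤ (κ * Cε * normL *
            (Real.exp 1 + κ * (2 : ℝ) ^ (2 * αε) * (2 : ℝ) ^ (1 - δ) * ((Cε + CF) / CF))) *
          (LRB.cbNorm K).toReal * ‖A‖ * (X.card : ℝ) *
          (t / (1 + d) ^ ((1 - δ) * αε - ν))) := by
  obtain rfl : α = αε + (ν + (1 + ε)) := by linarith
  clear hαε
  subst hv hd
  have hbound (t : ℝ) (ht : 0 ≤ t) (hvt : Real.exp 1 * (normL * CF) * t ≤ LRB.setDist X Y ^ δ) :=
    L.norm_extend_dynamics_embed_le_powerLaw hΓ hν (by linarith) hαε0 hδ hδ' hCε hL hnormL hCF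
      hX hY A hK hd0 ht hvt
  generalize κ * Cε * normL * _ = D at hbound ⊢
  refine ⟨⟨max 1 D, by positivity, fun t ht hvt => (hbound t ht hvt).trans ?_⟩, hbound⟩
  gcongr
  exact le_max_right _ _

theorem theorem2p6
    {Γ : Type*} [MetricSpace Γ] [Countable Γ] [DecidableEq Γ]
    {ι : Γ → Type*} [∀ x, Fintype (ι x)] [∀ x, DecidableEq (ι x)] [∀ x, Nonempty (ι x)]
    (κ ν : ℝ) (hκ : 0 < κ) (hν : 0 < ν) (hΓ : LRB.IsRegular Γ κ ν)
    (α : ℝ) (hα : 2 * ν + 1 < α)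
    (L : LRB.Interaction ι) (hL : L.fNorm (LRB.powerLaw α) < ∞)
    (ε : ℝ) (hε : 0 < ε) (hε' : ε < α - 2 * ν - 1)
    (αε : ℝ) (hαε : αε = α - ν - 1 - ε)
    (δ : ℝ) (hδ : 0 < δ) (hδ' : δ < 1) (hδα : ν < (1 - δ) * αε)
    (CF normL v Cε : ℝ)
    (hCF : CF = (LRB.convConst Γ (LRB.powerLaw α)).toReal)
    (hnormL : normL = (L.fNorm (LRB.powerLaw α)).toReal)
    (hv : v = normL * CF)
    (hCε : Cε = ∑' n : ℕ, 1 / (1 + (n : ℝ)) ^ (1 + ε))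
    (X Y Λ : Finset Γ) (hXY : Disjoint X Y) (hX : X ⊆ Λ) (hY : Y ⊆ Λ)
    (A : LRB.LocalAlg ι X) (K : LRB.LocalAlg ι Y →ₗ[ℂ] LRB.LocalAlg ι Y) (hK : LRB.IsCB0 K)
    (d : ℝ) (hd : d = LRB.setDist X Y) (hd1 : 1 ≤ d) :
    (∃ C : ℝ, 0 < C ∧ ∀ t : ℝ, 0 ≤ t → Real.exp 1 * v * t ≤ d ^ δ →
      ‖LRB.extend hY K (L.dynamics Λ t (LRB.embed hX A))‖
        ≤ C * (LRB.cbNorm K).toReal * ‖A‖ * (X.card : ℝ) *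
          (t / (1 + d) ^ ((1 - δ) * αε - ν))) ∧
    (∀ t : ℝ, 0 ≤ t → Real.exp 1 * v * t ≤ d ^ δ →
      ‖LRB.extend hY K (L.dynamics Λ t (LRB.embed hX A))‖
        ≤ (κ * Cε * normL *
            (Real.exp 1 + κ * (2 : ℝ) ^ (2 * αε) * (2 : ℝ) ^ (1 - δ) * ((Cε + CF) / CF))) *
          (LRB.cbNorm K).toReal * ‖A‖ * (X.card : ℝ) *
          (t / (1 + d) ^ ((1 - δ) * αε - ν))) :=
  theorem2p6_general κ ν hν.le hΓ α L hL ε hε αε hαε (by linarith) δ hδ.le hδ'.le CF normL v Cε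
    hCF hnormL hv hCε X Y Λ hX hY A K hK d hd (by linarith)
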